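/- Let $k$ be a field with $\operatorname{char}(k)\neq 2$. Let $V=k^6$ with basis $e_1,\dots,e_6$ and with the alternating form $Q$ determined by $Q(e_i,e_{i+3})=1$ for $i=1,2,3$ and $Q(e_i,e_j)=0$ for all other $i<j$; let $Sp_6(k)$ be the symplectic group of $Q$. Let $X_k=\ker(\phi)\subset\wedge^3V$ be the $14$-dimensional kernel of the contraction $\phi:\wedge^3V\to V$, $$\phi(v_1\wedge v_2\wedge v_3)=Q(v_2,v_3)v_1-Q(v_1,v_3)v_2+Q(v_1,v_2)v_3 .$$ Write $x_{ijl}$ for the coordinates of $x\in X_k$ with respect to the elements $e_ie_je_l:=e_i\wedge e_j\wedge e_l$ (alternating in the indices). Put $x_0=-x_{123}$ and $y_0=-x_{456}$, and let $A=(a_{ij})$ and $B=(b_{ij})$ be the symmetric $3\times 3$ matrices such that $a_{ij}$ is the coordinate whose index triple is $123$ with the $j$-th index replaced by $i+3$, and $b_{ij}$ is the coordinate whose index triple is $456$ with the $j$-th index replaced by $i$. Let $J$ be the $Sp_6$-invariant quartic form $$J(x)=x_0\det B+y_0\det A+\operatorname{tr}(A^{\#}B^{\#})-\tfrac14\bigl(x_0y_0-\operatorname{tr}(AB)\bigr)^2$$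 on $X_k$, where $\#$ denotes the adjugate. The group $(Sp_6\times GL_1)(k)=Sp_6(k)\times k^\times$ acts on $X_k$, with $k^\times$ acting by scalar multiplication. A composition algebra over $k$ is a nonzero unital, not necessarily associative $k$-algebra with a nondegenerate quadratic form $N_C$ (the norm) satisfying $N_C(xy)=N_C(x)N_C(y)$; isomorphisms are isomorphisms of the underlying algebras. **Theorem.** 1. For every nonzero $x\in X_k$ with $J(x)=0$, the $(Sp_6\times GL_1)(k)$-orbit of $x$ equals its $Sp_6(k)$-orbit. 2. The composition algebras over $k$ of dimension at most $4$ have dimension $1$, $2$ or $4$, and the nonzero $(Sp_6\times GL_1)(k)$-orbits in $J^{-1}(0)(k)$ are in bijection with the isomorphism classes of these algebras. 3. For all $a,b,c\in k^\times$ the vectors $$-e_1e_2e_3,\qquad -e_1e_2e_3+a\,e_1e_5e_6,\qquad a\,e_4e_2e_3+b\,e_1e_5e_3+c\,e_1e_2e_6$$ are nonzero elements of $J^{-1}(0)(k)$, and every nonzero orbit in $J^{-1}(0)(k)$ contains a vector of one of these forms. The bijection in 2 can be chosen such that, for all $a,b,c\in k^\times$, these vectors lie in the orbit corresponding to the class of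 $C$ if and only if $N_C$ is isometric to $\langle 1\rangle$, to $\langle 1,-a\rangle$, and to $\langle 1,bc,ac,ab\rangle$, respectively. -/

import Mathlib

/-! ### The 14-dimensional representation of `Sp₆` and its quartic invariant -/

noncomputable section

namespace SixSymplectic

universe u

/-- The six-dimensional space `V`.  The basis vector `e_i` (`i = 1, 2, 3`) is indexed by
`Sum.inl (i - 1)` and `e_{i+3}` by `Sum.inr (i - 1)`. -/
abbrev V (k : Type u) : Type u := Fin 3 ⊕ Fin 3 → k

/-- The symplectic group `Sp₆(k)`: the `6 × 6` matrices `g` with `g M gᵗ = M`, where `M` is the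
Gram matrix of the standard alternating form. -/
abbrev Sp6 (k : Type u) [Field k] : Submonoid (Matrix (Fin 3 ⊕ Fin 3) (Fin 3 ⊕ Fin 3) k) :=
  Matrix.symplecticGroup (Fin 3) k

/-- The third exterior power `⋀³ V`. -/
abbrev Wedge3 (k : Type u) [Field k] : Type u := ↥(⋀[k]^3 (V k))

/-- The action of a matrix on `⋀³ V` induced by its action `v ↦ g v` on `V`. -/
def act {k : Type u} [Field k] (g : Matrix (Fin 3 ⊕ Fin 3) (Fin 3 ⊕ Fin 3) k) :
    Wedge3 k →ₗ[k] Wedge3 k :=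
  exteriorPower.map 3 (Matrix.toLin' g)

/-- The standard alternating form on `V`, with Gram matrix `(0, I₃; -I₃, 0)`. -/
def Q {k : Type u} [Field k] (v w : V k) : k :=
  ∑ i : Fin 3, (v (Sum.inl i) * w (Sum.inr i) - v (Sum.inr i) * w (Sum.inl i))

/-- The alternating trilinear map
`(v₁, v₂, v₃) ↦ Q(v₂, v₃) v₁ - Q(v₁, v₃) v₂ + Q(v₁, v₂) v₃`. -/
def contractionAlt (k : Type u) [Field k] : V k [⋀^Fin 3]→ₗ[k] V k where
  toFun v := Q (v 1) (v 2) • v 0 - Q (v 0) (v 2) • v 1 + Q (v 0) (v 1) • v 2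
  map_update_add' := by
    intro inst m i x y
    obtain rfl : inst = instDecidableEqFin 3 := Subsingleton.elim _ _
    ext t
    fin_cases i <;>
      simp [Q, Fin.sum_univ_three, Function.update] <;> ring
  map_update_smul' := by
    intro inst m i c x
    obtain rfl : inst = instDecidableEqFin 3 := Subsingleton.elim _ _
    ext t
    fin_cases i <;>
      simp [Q, Fin.sum_univ_three, Function.update] <;> ring
  map_eq_zero_of_eq' := by
    intro v i j h hij
    ext t
    fin_cases i <;> fin_cases j <;> simp_all [Q, Fin.sum_univ_three] <;> ring_nf <;>
      simp

/-- The contraction `φ : ⋀³ V → V`. -/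
def contraction (k : Type u) [Field k] : Wedge3 k →ₗ[k] V k :=
  exteriorPower.alternatingMapLinearEquiv (contractionAlt k)

/-- The representation `X = ⋀³₀ V = ker φ` (its `k`-rational points), of dimension `14`. -/
def X (k : Type u) [Field k] : Submodule k (Wedge3 k) :=
  LinearMap.ker (contraction k)

/-- The coordinate `x_{s₀ s₁ s₂}` of `x ∈ ⋀³ V` with respect to the standard basis of `V`,
alternating in its three indices: it sends `v₁ ∧ v₂ ∧ v₃` to `det (vₐ(s_b))`. -/
def coord {k : Type u} [Field k] (s : Fin 3 → Fin 3 ⊕ Fin 3) : Wedge3 k →ₗ[k] k :=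
  exteriorPower.alternatingMapLinearEquiv
    ((Matrix.detRowAlternating (R := k) (n := Fin 3)).compLinearMap (LinearMap.funLeft k k s))

/-- `x₀ = -x₁₂₃`. -/
def x0 {k : Type u} [Field k] (x : Wedge3 k) : k := -coord Sum.inl x

/-- `y₀ = -x₄₅₆`. -/
def y0 {k : Type u} [Field k] (x : Wedge3 k) : k := -coord Sum.inr x

/-- The matrix `A`, whose entry `a_{ij}` is the coordinate whose index triple is `123` with the
`j`-th index replaced by `i + 3`; for instance `a₁₁ = x₄₂₃` and `a₁₂ = x₁₄₃`. -/
def matA {k : Type u} [Field k] (x : Wedge3 k) : Matrix (Fin 3) (Fin 3) k :=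
  Matrix.of fun i j => coord (Function.update Sum.inl j (Sum.inr i)) x

/-- The matrix `B`, whose entry `b_{ij}` is the coordinate whose index triple is `456` with the
`j`-th index replaced by `i`; for instance `b₁₁ = x₁₅₆` and `b₁₂ = x₄₁₆`. -/
def matB {k : Type u} [Field k] (x : Wedge3 k) : Matrix (Fin 3) (Fin 3) k :=
  Matrix.of fun i j => coord (Function.update Sum.inr j (Sum.inl i)) x

/-- The quartic `J(x) = x₀ det B + y₀ det A + tr(A^# B^#) - (1/4)(x₀ y₀ - tr(A B))²`, used for
`x ∈ X`; here `#` is the adjugate. -/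
def quarticJ {k : Type u} [Field k] (x : Wedge3 k) : k :=
  x0 x * (matB x).det + y0 x * (matA x).det + ((matA x).adjugate * (matB x).adjugate).trace
    - (1 / 4) * (x0 x * y0 x - (matA x * matB x).trace) ^ 2

/-- The nonzero part `J⁻¹(0)(k) - {0}` of the null cone in `X`. -/
def nonzeroNullCone (k : Type u) [Field k] : Set (Wedge3 k) :=
  {x | x ∈ X k ∧ quarticJ x = 0 ∧ x ≠ 0}

/-- The `Sp₆(k)`-orbit of `x`. -/
def spOrbit {k : Type u} [Field k] (x : Wedge3 k) : Set (Wedge3 k) :=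
  {y | ∃ g : Sp6 k, y = act g.1 x}

/-- The `(Sp₆ × GL₁)(k)`-orbit of `x`, where `GL₁` acts by scalar multiplication. -/
def spGLOrbit {k : Type u} [Field k] (x : Wedge3 k) : Set (Wedge3 k) :=
  {y | ∃ p : Sp6 k × kˣ, y = (p.2 : k) • act p.1.1 x}

/-- The set of nonzero `(Sp₆ × GL₁)(k)`-orbits in the null cone. -/
def nullOrbits (k : Type u) [Field k] : Set (Set (Wedge3 k)) :=
  {O | ∃ x ∈ nonzeroNullCone k, O = spGLOrbit x}

/-- The basis vector `e_i` of `V`. -/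
def e {k : Type u} [Field k] (i : Fin 3 ⊕ Fin 3) : V k := Pi.single i 1

/-- `u ∧ v ∧ w ∈ ⋀³ V`. -/
def wedge {k : Type u} [Field k] (u v w : V k) : Wedge3 k :=
  exteriorPower.ιMulti k 3 ![u, v, w]

/-- The vector `-e₁ ∧ e₂ ∧ e₃`. -/
def rep1 (k : Type u) [Field k] : Wedge3 k :=
  -wedge (e (.inl 0)) (e (.inl 1)) (e (.inl 2))

/-- The vector `-e₁ ∧ e₂ ∧ e₃ + a e₁ ∧ e₅ ∧ e₆`. -/
def rep2 {k : Type u} [Field k] (a : k) : Wedge3 k :=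
  -wedge (e (.inl 0)) (e (.inl 1)) (e (.inl 2))
    + a • wedge (e (.inl 0)) (e (.inr 1)) (e (.inr 2))

/-- The vector `a e₄ ∧ e₂ ∧ e₃ + b e₁ ∧ e₅ ∧ e₃ + c e₁ ∧ e₂ ∧ e₆`. -/
def rep4 {k : Type u} [Field k] (a b c : k) : Wedge3 k :=
  a • wedge (e (.inr 0)) (e (.inl 1)) (e (.inl 2))
    + b • wedge (e (.inl 0)) (e (.inr 1)) (e (.inl 2))
    + c • wedge (e (.inl 0)) (e (.inl 1)) (e (.inr 2))

/-! ### Composition algebras -/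

/-- A composition algebra over `k`: a nonzero unital, not necessarily associative `k`-algebra
with a nondegenerate multiplicative quadratic form. -/
structure CompositionAlgebra (k : Type u) [Field k] where
  carrier : Type u
  [ring : NonAssocRing carrier]
  [module : Module k carrier]
  [scalarTower : IsScalarTower k carrier carrier]
  [smulComm : SMulCommClass k carrier carrier]
  [nontrivial : Nontrivial carrier]
  norm : QuadraticForm k carrier
  nondegenerate : norm.polarBilin.Nondegenerate
  norm_mul : ∀ x y : carrier, norm (x * y) = norm x * norm y

attribute [instance] CompositionAlgebra.ring CompositionAlgebra.module
  CompositionAlgebra.scalarTower CompositionAlgebra.smulComm CompositionAlgebra.nontrivial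

/-- Composition algebras are isomorphic if the underlying algebras are. -/
def CompositionAlgebra.Iso {k : Type u} [Field k] (C D : CompositionAlgebra k) : Prop :=
  ∃ f : C.carrier ≃ₗ[k] D.carrier, ∀ x y : C.carrier, f (x * y) = f x * f y

/-- Composition algebras of dimension at most `4`. -/
def SmallCompositionAlgebra (k : Type u) [Field k] : Type (u + 1) :=
  {C : CompositionAlgebra k // Module.rank k C.carrier ≤ 4}

/-- Isomorphism as an equivalence relation on composition algebras of dimension at most `4`. -/
def isoSetoid (k : Type u) [Field k] : Setoid (SmallCompositionAlgebra k) where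
  r C D := C.1.Iso D.1
  iseqv :=
    { refl := fun _ => ⟨LinearEquiv.refl k _, fun _ _ => rfl⟩
      symm := by
        rintro C D ⟨f, hf⟩
        exact ⟨f.symm, fun x y => f.injective (by simp [hf])⟩
      trans := by
        rintro C D E ⟨f, hf⟩ ⟨g, hg⟩
        exact ⟨f.trans g, fun x y => by simp [hf, hg]⟩ }

/-- The set of isomorphism classes of composition algebras of dimension at most `4`. -/
def SmallClasses (k : Type u) [Field k] : Type (u + 1) := Quotient (isoSetoid k)

/-- The isomorphism class of a composition algebra of dimension at most `4`. -/
def isoClass {k : Type u} [Field k] (C : SmallCompositionAlgebra k) : SmallClasses k :=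
  Quotient.mk (isoSetoid k) C

/-- The norm of `C` is isometric to the diagonal form `⟨w₀, …, w_{n-1}⟩`. -/
def HasNorm {k : Type u} [Field k] (C : SmallCompositionAlgebra k) {n : ℕ} (w : Fin n → k) :
    Prop :=
  QuadraticMap.Equivalent C.1.norm (QuadraticMap.weightedSumSquares k w)

end SixSymplectic

end

/-! An element of `X` is a quadruple `(x₀, A, B, y₀)` with `A`, `B` symmetric (`mem_X_iff`). Three
kinds of symplectic elements do almost all the work: the unipotents `upper S`, the Levi elements,
which act on `B` by `B ↦ det(h)⁻¹ h B hᵀ` once `A = 0`, and the Weyl element `J`, which exchanges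
the roles of `A` and `B`. Only invariance of the quartic under `upper S` and `J` is needed.

Normal forms (`exists_rep_mem_spOrbit`). A nonzero vector can be moved to one with `x₀ ≠ 0`, and an
opposite unipotent then makes `A = 0`. The equation of the cone becomes `4 det B = x₀ y₀²`. If `y₀ =
0`, then `B` is degenerate; diagonalising it gives rank 0, 1 or 2, which lead to the three normal
forms. If `y₀ ≠ 0`, one opposite unipotent kills `B` and `y₀` together and leaves a nondegenerate
`A`, which gives the third form. Levi elements realise scalar multiplication on each normal form, so
scalars do not enlarge orbits (`smul_mem_spOrbit`).

Separation of orbits. The quadratic map `covariant`, with values in symmetric matrices, satisfies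
`covariant (g x) = g (covariant x) gᵀ`. On the normal forms it is `-4` times `diag(0,0,0)`,
`diag(a,0,0)`, `diag(bc,ac,ab)`. Vectors in one orbit therefore have congruent diagonal forms.
Conversely, congruent forms of the same type come from one orbit (`rep2_mem_of_eq`,
`rep4_mem_of_congruent`).

Composition algebras. Polarising multiplicativity of the norm yields enough alternativity to show
that orthogonal pure elements generate `k`, `k[√a]` or a quaternion algebra (`iso_standard`), and
that the norm determines the algebra (`exists_pure` and the `equivalent_alg*_iff` lemmas). Up to
sign, `⟨a⟩` and `⟨bc,ac,ab⟩` are the norms on the pure parts, and their congruence is the same as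
isomorphism of the algebras. Orbits and isomorphism classes are thus quotients of the one set
`NormalForm` by the same relation. -/

set_option linter.unusedSimpArgs false

noncomputable section

namespace SixSymplectic

open Matrix

variable {k : Type*} [Field k]

/-! ### Coordinates on the exterior cube -/

/-- The coordinate tensor of an element of `⋀³ V`. -/
def tens (x : Wedge3 k) (i j l : Fin 3 ⊕ Fin 3) : k := coord ![i, j, l] x

theorem coord_ιMulti (s : Fin 3 → Fin 3 ⊕ Fin 3) (v : Fin 3 → V k) :
    coord s (exteriorPower.ιMulti k 3 v) = (Matrix.of fun a b => v a (s b)).det := by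
  simp only [coord, exteriorPower.alternatingMapLinearEquiv_apply_ιMulti]
  rfl

theorem tens_ιMulti (v : Fin 3 → V k) (i j l : Fin 3 ⊕ Fin 3) :
    tens (exteriorPower.ιMulti k 3 v) i j l =
      v 0 i * v 1 j * v 2 l - v 0 i * v 1 l * v 2 j - v 0 j * v 1 i * v 2 l
        + v 0 j * v 1 l * v 2 i + v 0 l * v 1 i * v 2 j - v 0 l * v 1 j * v 2 i := by
  simp [tens, coord_ιMulti, Matrix.det_fin_three]

theorem wedge3_induction {p : Wedge3 k → Prop} (x : Wedge3 k)
    (hι : ∀ v, p (exteriorPower.ιMulti k 3 v)) (h0 : p 0) (hadd : ∀ x y, p x → p y → p (x + y))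
    (hsmul : ∀ (c : k) x, p x → p (c • x)) : p x := by
  have hx : x ∈ Submodule.span k (Set.range (exteriorPower.ιMulti k 3 (M := V k))) := by
    rw [exteriorPower.ιMulti_span]; trivial
  induction hx using Submodule.span_induction with
  | mem x h => obtain ⟨v, rfl⟩ := h; exact hι v
  | zero => exact h0
  | add x y _ _ hx hy => exact hadd x y hx hy
  | smul c x _ hx => exact hsmul c x hx

@[simp] theorem tens_add (x y : Wedge3 k) (i j l) :
    tens (x + y) i j l = tens x i j l + tens y i j l := map_add _ _ _

@[simp] theorem tens_smul (c : k) (x : Wedge3 k) (i j l) :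
    tens (c • x) i j l = c * tens x i j l := map_smul _ _ _

@[simp] theorem tens_neg (x : Wedge3 k) (i j l) :
    tens (-x) i j l = -tens x i j l := map_neg _ _

@[simp] theorem tens_zero (i j l) : tens (0 : Wedge3 k) i j l = 0 := map_zero _

theorem tens_swap_left (x : Wedge3 k) (i j l) : tens x i j l = -tens x j i l := by
  induction x using wedge3_induction with
  | hι v => simp only [tens_ιMulti]; ring
  | h0 => simp
  | hadd x y hx hy => simp only [tens_add, hx, hy]; ring
  | hsmul c x hx => simp only [tens_smul, hx]; ring

theorem tens_swap_right (x : Wedge3 k) (i j l) : tens x i j l = -tens x i l j := by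
  induction x using wedge3_induction with
  | hι v => simp only [tens_ιMulti]; ring
  | h0 => simp
  | hadd x y hx hy => simp only [tens_add, hx, hy]; ring
  | hsmul c x hx => simp only [tens_smul, hx]; ring

@[simp] theorem tens_self_left (x : Wedge3 k) (i l) : tens x i i l = 0 := by
  induction x using wedge3_induction with
  | hι v => simp only [tens_ιMulti]; ring
  | h0 => simp
  | hadd x y hx hy => simp only [tens_add, hx, hy]; ring
  | hsmul c x hx => simp only [tens_smul, hx]; ring

@[simp] theorem tens_self_right (x : Wedge3 k) (i l) : tens x l i i = 0 := by
  induction x using wedge3_induction with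
  | hι v => simp only [tens_ιMulti]; ring
  | h0 => simp
  | hadd x y hx hy => simp only [tens_add, hx, hy]; ring
  | hsmul c x hx => simp only [tens_smul, hx]; ring

@[simp] theorem tens_self_outer (x : Wedge3 k) (i l) : tens x i l i = 0 := by
  rw [tens_swap_left]; simp

theorem act_ιMulti (g : Matrix (Fin 3 ⊕ Fin 3) (Fin 3 ⊕ Fin 3) k) (v : Fin 3 → V k) :
    act g (exteriorPower.ιMulti k 3 v) = exteriorPower.ιMulti k 3 (fun a => g *ᵥ v a) := by
  simp only [act, exteriorPower.map_apply_ιMulti]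
  rfl

/-- The sums are nested, with each matrix entry pulled out, so that sparse rows of `g` collapse one
index at a time under `sum_fromBlocks_inl`, `sum_one_mul` and the like, before any expansion. -/
theorem tens_act (g : Matrix (Fin 3 ⊕ Fin 3) (Fin 3 ⊕ Fin 3) k) (x : Wedge3 k) (i j l) :
    tens (act g x) i j l =
      ∑ a, g i a * ∑ b, g j b * ∑ c, g l c * tens x a b c := by
  induction x using wedge3_induction with
  | hι v =>
    rw [act_ιMulti]
    have key : ∀ u w z : V k, (g *ᵥ u) i * (g *ᵥ w) j * (g *ᵥ z) l =
        ∑ a, g i a * ∑ b, g j b * ∑ c, g l c * (u a * w b * z c) := by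
      intro u w z
      simp only [mulVec, dotProduct]
      simp only [Finset.sum_mul, mul_assoc]
      refine Finset.sum_congr rfl fun a _ => ?_
      simp only [Finset.mul_sum]
      refine Finset.sum_congr rfl fun b _ => Finset.sum_congr rfl fun c _ => ?_
      ring
    have e1 : ∀ a b c, tens (exteriorPower.ιMulti k 3 v) a b c =
      v 0 a * v 1 b * v 2 c - v 0 a * v 2 b * v 1 c - v 1 a * v 0 b * v 2 c
        + v 2 a * v 0 b * v 1 c + v 1 a * v 2 b * v 0 c - v 2 a * v 1 b * v 0 c := by
      intro a b c; rw [tens_ιMulti]; ring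
    simp only [e1, mul_add, mul_sub, Finset.sum_add_distrib, Finset.sum_sub_distrib, ← key]
    rw [tens_ιMulti]; ring
  | h0 => simp
  | hadd x y hx hy => simp only [map_add, tens_add, hx, hy, mul_add, Finset.sum_add_distrib]
  | hsmul c x hx =>
    simp only [map_smul, tens_smul, hx, Finset.mul_sum]
    refine Finset.sum_congr rfl fun a _ => Finset.sum_congr rfl fun b _ =>
      Finset.sum_congr rfl fun c _ => ?_
    ring

/-! ### The blocks of coordinates -/

theorem x0_eq (x : Wedge3 k) : x0 x = -tens x (.inl 0) (.inl 1) (.inl 2) := by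
  have : (Sum.inl : Fin 3 → Fin 3 ⊕ Fin 3) = ![.inl 0, .inl 1, .inl 2] := by
    funext i; fin_cases i <;> rfl
  rw [x0, this]; rfl

theorem y0_eq (x : Wedge3 k) : y0 x = -tens x (.inr 0) (.inr 1) (.inr 2) := by
  have : (Sum.inr : Fin 3 → Fin 3 ⊕ Fin 3) = ![.inr 0, .inr 1, .inr 2] := by
    funext i; fin_cases i <;> rfl
  rw [y0, this]; rfl

theorem tens_inl_inl_inl (x : Wedge3 k) : tens x (.inl 0) (.inl 1) (.inl 2) = -x0 x := by
  rw [x0_eq, neg_neg]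

theorem tens_inr_inr_inr (x : Wedge3 k) : tens x (.inr 0) (.inr 1) (.inr 2) = -y0 x := by
  rw [y0_eq, neg_neg]

theorem tens_12 (x : Wedge3 k) (i) : tens x (.inl 1) (.inl 2) (.inr i) = matA x i 0 := by
  rw [tens_swap_right, tens_swap_left, neg_neg, tens, matA, of_apply]
  congr 2; funext j; fin_cases j <;> rfl

theorem tens_02 (x : Wedge3 k) (i) : tens x (.inl 0) (.inl 2) (.inr i) = -matA x i 1 := by
  rw [tens_swap_right, tens, matA, of_apply]
  congr 3; funext j; fin_cases j <;> rfl

theorem tens_01 (x : Wedge3 k) (i) : tens x (.inl 0) (.inl 1) (.inr i) = matA x i 2 := by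
  rw [tens, matA, of_apply]
  congr 2; funext j; fin_cases j <;> rfl

theorem tens_45 (x : Wedge3 k) (i) : tens x (.inl i) (.inr 1) (.inr 2) = matB x i 0 := by
  rw [tens, matB, of_apply]
  congr 2; funext j; fin_cases j <;> rfl

theorem tens_35 (x : Wedge3 k) (i) : tens x (.inl i) (.inr 0) (.inr 2) = -matB x i 1 := by
  rw [tens_swap_left, tens, matB, of_apply]
  congr 3; funext j; fin_cases j <;> rfl

theorem tens_34 (x : Wedge3 k) (i) : tens x (.inl i) (.inr 0) (.inr 1) = matB x i 2 := by
  rw [tens_swap_left, tens_swap_right, neg_neg, tens, matB, of_apply]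
  congr 2; funext j; fin_cases j <;> rfl

theorem tens_inr_inl_left (x : Wedge3 k) (i j q) :
    tens x (.inr i) (.inl j) q = -tens x (.inl j) (.inr i) q := tens_swap_left ..

theorem tens_inr_inl_right (x : Wedge3 k) (i j p) :
    tens x p (.inr i) (.inl j) = -tens x p (.inl j) (.inr i) := tens_swap_right ..

/-- Only decreasing pairs of indices are rewritten, so the instances for `Sum.inl` and `Sum.inr`
sort indices as simp rules, where the unrestricted swap would loop. -/
theorem tens_left_of_ne (x : Wedge3 k) (s : Fin 3 → Fin 3 ⊕ Fin 3) (q) :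
    tens x (s 1) (s 0) q = -tens x (s 0) (s 1) q ∧
    tens x (s 2) (s 0) q = -tens x (s 0) (s 2) q ∧
    tens x (s 2) (s 1) q = -tens x (s 1) (s 2) q :=
  ⟨tens_swap_left .., tens_swap_left .., tens_swap_left ..⟩

theorem tens_right_of_ne (x : Wedge3 k) (s : Fin 3 → Fin 3 ⊕ Fin 3) (q) :
    tens x q (s 1) (s 0) = -tens x q (s 0) (s 1) ∧
    tens x q (s 2) (s 0) = -tens x q (s 0) (s 2) ∧
    tens x q (s 2) (s 1) = -tens x q (s 1) (s 2) :=
  ⟨tens_swap_right .., tens_swap_right .., tens_swap_right ..⟩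

theorem tens_inl_left (x : Wedge3 k) (q) :
    tens x (.inl 1) (.inl 0) q = -tens x (.inl 0) (.inl 1) q ∧
    tens x (.inl 2) (.inl 0) q = -tens x (.inl 0) (.inl 2) q ∧
    tens x (.inl 2) (.inl 1) q = -tens x (.inl 1) (.inl 2) q := tens_left_of_ne x _ q

theorem tens_inr_left (x : Wedge3 k) (q) :
    tens x (.inr 1) (.inr 0) q = -tens x (.inr 0) (.inr 1) q ∧
    tens x (.inr 2) (.inr 0) q = -tens x (.inr 0) (.inr 2) q ∧
    tens x (.inr 2) (.inr 1) q = -tens x (.inr 1) (.inr 2) q := tens_left_of_ne x _ q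

theorem tens_inl_right (x : Wedge3 k) (q) :
    tens x q (.inl 1) (.inl 0) = -tens x q (.inl 0) (.inl 1) ∧
    tens x q (.inl 2) (.inl 0) = -tens x q (.inl 0) (.inl 2) ∧
    tens x q (.inl 2) (.inl 1) = -tens x q (.inl 1) (.inl 2) := tens_right_of_ne x _ q

theorem tens_inr_right (x : Wedge3 k) (q) :
    tens x q (.inr 1) (.inr 0) = -tens x q (.inr 0) (.inr 1) ∧
    tens x q (.inr 2) (.inr 0) = -tens x q (.inr 0) (.inr 2) ∧
    tens x q (.inr 2) (.inr 1) = -tens x q (.inr 1) (.inr 2) := tens_right_of_ne x _ q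

attribute [simp] tens_inl_inl_inl tens_inr_inr_inr tens_12 tens_02 tens_01 tens_45 tens_35
  tens_34 tens_inr_inl_left tens_inr_inl_right tens_inl_left tens_inr_left tens_inl_right
  tens_inr_right

/-- The dual basis of the exterior cube consists of the functionals `coord t` with `t` increasing.
The reindexing by `finSumFinEquiv` supplies the linear order that this basis needs. -/
theorem eq_zero_of_tens (x : Wedge3 k) (h : ∀ i j l, tens x i j l = 0) : x = 0 := by
  let b := (Pi.basisFun k (Fin 3 ⊕ Fin 3)).reindex finSumFinEquiv
  refine (b.exteriorPower 3).repr.map_eq_zero_iff.mp (Finsupp.ext fun s => ?_)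
  rw [exteriorPower.basis_repr_apply]
  let t : Fin 3 → Fin 3 ⊕ Fin 3 := fun j =>
    finSumFinEquiv.symm (Set.powersetCard.ofFinEmbEquiv.symm s j)
  have : exteriorPower.ιMultiDual k 3 b s = coord t := by
    refine exteriorPower.linearMap_ext (AlternatingMap.ext fun v => ?_)
    simp only [LinearMap.compAlternatingMap_apply, exteriorPower.ιMultiDual_apply_ιMulti,
      coord_ιMulti]
    congr 1
  rw [this]
  have ht : t = ![t 0, t 1, t 2] := by funext j; fin_cases j <;> rfl
  rw [ht]
  exact h _ _ _

theorem eq_zero_of_blocks (x : Wedge3 k) (hx : x0 x = 0) (hA : matA x = 0) (hB : matB x = 0)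
    (hy : y0 x = 0) : x = 0 := by
  refine eq_zero_of_tens x ?_
  rintro (i | i) (j | j) (l | l) <;> fin_cases i <;> fin_cases j <;> fin_cases l <;>
    simp [hx, hA, hB, hy]

theorem x0_sub (x y : Wedge3 k) : x0 (x - y) = x0 x - x0 y := by
  simp [x0, sub_eq_add_neg, add_comm]

theorem y0_sub (x y : Wedge3 k) : y0 (x - y) = y0 x - y0 y := by
  simp [y0, sub_eq_add_neg, add_comm]

theorem matA_sub (x y : Wedge3 k) : matA (x - y) = matA x - matA y := by
  ext i j; simp [matA]

theorem matB_sub (x y : Wedge3 k) : matB (x - y) = matB x - matB y := by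
  ext i j; simp [matB]

theorem ext_blocks {x y : Wedge3 k} (hx : x0 x = x0 y) (hA : matA x = matA y)
    (hB : matB x = matB y) (hy : y0 x = y0 y) : x = y :=
  sub_eq_zero.mp (eq_zero_of_blocks _ (by simp [x0_sub, hx]) (by simp [matA_sub, hA])
    (by simp [matB_sub, hB]) (by simp [y0_sub, hy]))

theorem matA_col0 (x : Wedge3 k) (i) : matA x i 0 = tens x (.inl 1) (.inl 2) (.inr i) :=
  (tens_12 x i).symm

theorem matA_col1 (x : Wedge3 k) (i) : matA x i 1 = -tens x (.inl 0) (.inl 2) (.inr i) := by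
  rw [tens_02, neg_neg]

theorem matA_col2 (x : Wedge3 k) (i) : matA x i 2 = tens x (.inl 0) (.inl 1) (.inr i) :=
  (tens_01 x i).symm

theorem matB_col0 (x : Wedge3 k) (i) : matB x i 0 = tens x (.inl i) (.inr 1) (.inr 2) :=
  (tens_45 x i).symm

theorem matB_col1 (x : Wedge3 k) (i) : matB x i 1 = -tens x (.inl i) (.inr 0) (.inr 2) := by
  rw [tens_35, neg_neg]

theorem matB_col2 (x : Wedge3 k) (i) : matB x i 2 = tens x (.inl i) (.inr 0) (.inr 1) :=
  (tens_34 x i).symm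

/-! ### The kernel of the contraction -/

theorem contraction_ιMulti (v : Fin 3 → V k) :
    contraction k (exteriorPower.ιMulti k 3 v) =
      Q (v 1) (v 2) • v 0 - Q (v 0) (v 2) • v 1 + Q (v 0) (v 1) • v 2 := by
  simp only [contraction, exteriorPower.alternatingMapLinearEquiv_apply_ιMulti]
  rfl

theorem contraction_apply (x : Wedge3 k) (l) :
    contraction k x l = ∑ i : Fin 3, tens x (.inl i) (.inr i) l := by
  induction x using wedge3_induction with
  | hι v =>
    rw [contraction_ιMulti]
    simp only [tens_ιMulti, Q, Fin.sum_univ_three, Pi.add_apply, Pi.sub_apply, Pi.smul_apply,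
      smul_eq_mul]
    ring
  | h0 => simp
  | hadd x y hx hy => simp only [map_add, Pi.add_apply, hx, hy, tens_add, Finset.sum_add_distrib]
  | hsmul c x hx =>
    simp only [map_smul, Pi.smul_apply, smul_eq_mul, hx, tens_smul, Finset.mul_sum]

/-- In each of the six coordinates of the contraction, the term with a repeated index vanishes and
the other two are, up to sign, a pair of mirror entries of `A` or `B`. -/
theorem mem_X_iff (x : Wedge3 k) : x ∈ X k ↔ (matA x).IsSymm ∧ (matB x).IsSymm := by
  have h : x ∈ X k ↔ ∀ l, ∑ i : Fin 3, tens x (.inl i) (.inr i) l = 0 := by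
    rw [X, LinearMap.mem_ker, funext_iff]
    simp only [contraction_apply, Pi.zero_apply]
  rw [h, Sum.forall]
  simp only [Fin.forall_fin_succ, Fin.sum_univ_three, IsSymm.ext_iff]
  simp
  constructor
  · rintro ⟨⟨h1, h2, h3⟩, h4, h5, h6⟩
    refine ⟨⟨⟨?_, ?_⟩, ⟨?_, ?_⟩, ?_, ?_⟩, ⟨?_, ?_⟩, ⟨?_, ?_⟩, ?_, ?_⟩ <;> grind
  · rintro ⟨⟨⟨h1, h2⟩, ⟨-, h3⟩, -⟩, ⟨h4, h5⟩, ⟨-, h6⟩, -⟩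
    simp [h1, h2, h3, h4, h5, h6]

theorem Q_eq (v w : V k) : Q v w = -(v ⬝ᵥ (Matrix.J (Fin 3) k *ᵥ w)) := by
  simp [Q, Matrix.J, dotProduct, Fintype.sum_sum_type, fromBlocks_mulVec, Matrix.neg_mulVec,
    Finset.sum_sub_distrib]
  try ring

theorem Q_mulVec (g : Sp6 k) (v w : V k) : Q (g.1 *ᵥ v) (g.1 *ᵥ w) = Q v w := by
  have h := SymplecticGroup.mem_iff'.mp g.2
  rw [Q_eq, Q_eq, dotProduct_mulVec, ← vecMul_transpose, vecMul_vecMul, dotProduct_mulVec,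
    vecMul_vecMul, h, dotProduct_mulVec]

theorem contraction_act (g : Sp6 k) (x : Wedge3 k) :
    contraction k (act g.1 x) = g.1 *ᵥ contraction k x := by
  induction x using wedge3_induction with
  | hι v =>
    simp only [act_ιMulti, contraction_ιMulti, Q_mulVec, mulVec_add, mulVec_sub, mulVec_smul]
  | h0 => simp
  | hadd x y hx hy => simp only [map_add, hx, hy, mulVec_add]
  | hsmul c x hx => simp only [map_smul, hx, mulVec_smul]

theorem act_mem_X (g : Sp6 k) {x : Wedge3 k} (hx : x ∈ X k) : act g.1 x ∈ X k := by
  rw [X, LinearMap.mem_ker] at hx ⊢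
  rw [contraction_act, hx, mulVec_zero]

theorem act_mul (g h : Matrix (Fin 3 ⊕ Fin 3) (Fin 3 ⊕ Fin 3) k) (x : Wedge3 k) :
    act (g * h) x = act g (act h x) := by
  simp only [act, toLin'_mul, exteriorPower.map_comp, LinearMap.comp_apply]

theorem act_one (x : Wedge3 k) : act (1 : Matrix (Fin 3 ⊕ Fin 3) (Fin 3 ⊕ Fin 3) k) x = x := by
  simp only [act, toLin'_one, exteriorPower.map_id, LinearMap.id_apply]

/-! ### A quadratic covariant -/

/-- The contraction of the coordinate tensor with the `i`-th coordinate vector. -/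
def slice (x : Wedge3 k) (i : Fin 3 ⊕ Fin 3) : Matrix (Fin 3 ⊕ Fin 3) (Fin 3 ⊕ Fin 3) k :=
  Matrix.of fun j l => tens x i j l

/-- The Gram matrix of the quadratic form on `V*` attached to `x`, with values in `Sym² V`. -/
def covariant (x : Wedge3 k) : Matrix (Fin 3 ⊕ Fin 3) (Fin 3 ⊕ Fin 3) k :=
  Matrix.of fun i j => (slice x i * J (Fin 3) k * slice x j * J (Fin 3) k).trace

theorem slice_act (g : Matrix (Fin 3 ⊕ Fin 3) (Fin 3 ⊕ Fin 3) k) (x : Wedge3 k) (i) :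
    slice (act g x) i = ∑ a, g i a • (g * slice x a * gᵀ) := by
  ext j l
  simp only [slice, of_apply, tens_act, Matrix.sum_apply, Matrix.smul_apply, smul_eq_mul]
  refine Finset.sum_congr rfl fun a _ => ?_
  congr 1
  rw [mul_assoc]
  simp only [mul_apply, transpose_apply, of_apply]
  simp only [mul_comm]

/-- The slices transform linearly in their index and by `S ↦ g S gᵀ` in the other two; since `gᵀ J g
= J`, the trace pairing is unchanged and only the action on the index survives. This invariant
separates the orbits. -/
theorem covariant_act (g : Sp6 k) (x : Wedge3 k) :
    covariant (act g.1 x) = g.1 * covariant x * g.1ᵀ := by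
  have h := SymplecticGroup.mem_iff'.mp g.2
  have key : ∀ S T : Matrix (Fin 3 ⊕ Fin 3) (Fin 3 ⊕ Fin 3) k,
      (g.1 * S * g.1ᵀ * J (Fin 3) k * (g.1 * T * g.1ᵀ) * J (Fin 3) k).trace =
        (S * J (Fin 3) k * T * J (Fin 3) k).trace := by
    intro S T
    calc _ = (g.1 * (S * (g.1ᵀ * J (Fin 3) k * g.1) * T * g.1ᵀ * J (Fin 3) k)).trace := by
          simp only [Matrix.mul_assoc]
      _ = (S * (g.1ᵀ * J (Fin 3) k * g.1) * T * (g.1ᵀ * J (Fin 3) k * g.1)).trace := by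
          rw [trace_mul_comm]; simp only [Matrix.mul_assoc]
      _ = _ := by rw [h]
  ext i j
  simp only [covariant, of_apply, slice_act]
  simp only [Matrix.sum_mul, Matrix.mul_sum, trace_sum, Matrix.smul_mul, Matrix.mul_smul, trace_smul, key]
  simp only [mul_apply, transpose_apply, of_apply, smul_eq_mul, Finset.sum_mul]
  refine Finset.sum_congr rfl fun a _ => ?_
  rw [Finset.mul_sum]
  refine Finset.sum_congr rfl fun b _ => ?_
  ring

/-! ### The quartic on the kernel of the contraction -/

/-- Four times the quartic as a polynomial in the entries of symmetric matrices. -/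
def quarticPoly (x a b c d e f p q r s t u y : k) : k :=
  4 * (x * (p * (s * u - t ^ 2) - q * (q * u - r * t) + r * (q * t - r * s)) +
    y * (a * (d * f - e ^ 2) - b * (b * f - c * e) + c * (b * e - c * d)) +
    ((d * f - e ^ 2) * (s * u - t ^ 2) + (a * f - c ^ 2) * (p * u - r ^ 2) +
    (a * d - b ^ 2) * (p * s - q ^ 2) + 2 * ((c * e - b * f) * (r * t - q * u) +
      (b * e - c * d) * (q * t - r * s) + (b * c - a * e) * (q * r - p * t)))) -
   (x * y - (a * p + d * s + f * u + 2 * (b * q + c * r + e * t))) ^ 2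

theorem quarticJ_eq (h2 : (2 : k) ≠ 0) {x : Wedge3 k} (hx : x ∈ X k) :
    4 * quarticJ x = quarticPoly (x0 x) (matA x 0 0) (matA x 0 1) (matA x 0 2) (matA x 1 1)
      (matA x 1 2) (matA x 2 2) (matB x 0 0) (matB x 0 1) (matB x 0 2) (matB x 1 1)
      (matB x 1 2) (matB x 2 2) (y0 x) := by
  obtain ⟨hA, hB⟩ := (mem_X_iff x).mp hx
  have h4 : (4 : k) ≠ 0 := by
    rw [show (4 : k) = 2 * 2 by norm_num]; exact mul_ne_zero h2 h2
  have e : (4 : k) * (1 / 4) = 1 := by field_simp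
  rw [quarticJ, mul_sub, ← mul_assoc, e, one_mul, quarticPoly]
  simp only [det_fin_three, adjugate_fin_three, trace_fin_three, mul_apply, Fin.sum_univ_three,
    hA.apply 0 1, hA.apply 0 2, hA.apply 1 2, hB.apply 0 1, hB.apply 0 2, hB.apply 1 2]
  simp
  ring

-- The arguments on the left are the coordinates after `upper S`, where `S` has upper triangular
-- entries `g h i`, `j l`, `m`. Invariance of the quartic under these unipotents becomes a
-- polynomial identity, with the factor 4 clearing the denominator.
set_option maxHeartbeats 1000000 in
theorem quarticPoly_upper (x a b c d e f p q r s t u y g h i j l m : k) :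
    quarticPoly
      (x - (a * g + d * j + f * m + 2 * (b * h + c * i + e * l))
        - (p * (j * m - l ^ 2) + s * (g * m - i ^ 2) + u * (g * j - h ^ 2)
          + 2 * (q * (i * l - h * m) + r * (h * l - i * j) + t * (h * i - g * l)))
        + y * (g * (j * m - l ^ 2) - h * (h * m - i * l) + i * (h * l - i * j)))
      (a + (s * m + u * j - 2 * t * l) - y * (j * m - l ^ 2))
      (b + (r * l + i * t - q * m - h * u) - y * (i * l - h * m))
      (c + (q * l + h * t - r * j - i * s) - y * (h * l - i * j))
      (d + (p * m + g * u - 2 * r * i) - y * (g * m - i ^ 2))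
      (e + (q * i + h * r - p * l - g * t) - y * (h * i - g * l))
      (f + (p * j + g * s - 2 * q * h) - y * (g * j - h ^ 2))
      (p - y * g) (q - y * h) (r - y * i) (s - y * j) (t - y * l) (u - y * m) y =
    quarticPoly x a b c d e f p q r s t u y := by
  simp only [quarticPoly]
  ring

/-! ### Elements of the symplectic group -/

theorem sum_fromBlocks_inl (A B C D : Matrix (Fin 3) (Fin 3) k) (i : Fin 3)
    (f : Fin 3 ⊕ Fin 3 → k) :
    ∑ a, fromBlocks A B C D (.inl i) a * f a =
      ∑ a, A i a * f (.inl a) + ∑ a, B i a * f (.inr a) := by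
  simp [Fintype.sum_sum_type]

theorem sum_fromBlocks_inr (A B C D : Matrix (Fin 3) (Fin 3) k) (i : Fin 3)
    (f : Fin 3 ⊕ Fin 3 → k) :
    ∑ a, fromBlocks A B C D (.inr i) a * f a =
      ∑ a, C i a * f (.inl a) + ∑ a, D i a * f (.inr a) := by
  simp [Fintype.sum_sum_type]

theorem sum_one_mul (i : Fin 3) (f : Fin 3 → k) :
    ∑ a, (1 : Matrix (Fin 3) (Fin 3) k) i a * f a = f i := by
  simp [one_apply]

theorem sum_zero_mul (i : Fin 3) (f : Fin 3 → k) :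
    ∑ a, (0 : Matrix (Fin 3) (Fin 3) k) i a * f a = 0 := by
  simp

theorem sum_neg_one_mul (i : Fin 3) (f : Fin 3 → k) :
    ∑ a, (-1 : Matrix (Fin 3) (Fin 3) k) i a * f a = -f i := by
  simp [one_apply]

/-- The unipotent element `e_{i+3} ↦ e_{i+3} + ∑ⱼ S_{ji} e_j`. -/
def upper (S : Matrix (Fin 3) (Fin 3) k) (hS : S.IsSymm) : Sp6 k :=
  ⟨fromBlocks 1 S 0 1, by
    rw [SymplecticGroup.fromBlocks_mem_iff]
    simp [hS.eq]⟩

/-- The element of the Levi subgroup given by `h` and its inverse transpose `P`. -/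
def levi (h P : Matrix (Fin 3) (Fin 3) k) (hP : hᵀ * P = 1) : Sp6 k :=
  ⟨fromBlocks h 0 0 P, by
    rw [SymplecticGroup.fromBlocks_mem_iff]
    simp [hP]⟩

theorem x0_act_J (x : Wedge3 k) : x0 (act (J (Fin 3) k) x) = -y0 x := by
  simp only [J, x0_eq, tens_act, sum_fromBlocks_inl, sum_neg_one_mul, sum_zero_mul]
  simp

theorem y0_act_J (x : Wedge3 k) : y0 (act (J (Fin 3) k) x) = x0 x := by
  simp only [J, y0_eq, tens_act, sum_fromBlocks_inr, sum_one_mul, sum_zero_mul]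
  simp

theorem matA_act_J (x : Wedge3 k) : matA (act (J (Fin 3) k) x) = matB x := by
  ext i j
  fin_cases j <;>
    simp only [Fin.reduceFinMk, Fin.zero_eta, J, matA_col0, matA_col1, matA_col2, tens_act,
      sum_fromBlocks_inl, sum_fromBlocks_inr, sum_neg_one_mul, sum_one_mul, sum_zero_mul] <;>
    simp

theorem matB_act_J (x : Wedge3 k) : matB (act (J (Fin 3) k) x) = -matA x := by
  ext i j
  fin_cases j <;>
    simp only [Fin.reduceFinMk, Fin.zero_eta, J, matB_col0, matB_col1, matB_col2, tens_act,
      sum_fromBlocks_inl, sum_fromBlocks_inr, sum_neg_one_mul, sum_one_mul, sum_zero_mul] <;>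
    simp

theorem x0_act_upper {S : Matrix (Fin 3) (Fin 3) k} (hS : S.IsSymm) {x : Wedge3 k}
    (hx : x ∈ X k) :
    x0 (act (upper S hS).1 x) =
      x0 x - (matA x * S).trace - (matB x * S.adjugate).trace + y0 x * S.det := by
  obtain ⟨hA, hB⟩ := (mem_X_iff x).mp hx
  simp only [upper, x0_eq, tens_act, sum_fromBlocks_inl, sum_one_mul]
  simp [Fin.sum_univ_three, trace_fin_three, mul_apply, det_fin_three, adjugate_fin_three,
    hA.apply 0 1, hA.apply 0 2, hA.apply 1 2, hB.apply 0 1, hB.apply 0 2, hB.apply 1 2,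
    hS.apply 0 1, hS.apply 0 2, hS.apply 1 2]
  ring

theorem y0_act_upper {S : Matrix (Fin 3) (Fin 3) k} (hS : S.IsSymm) (x : Wedge3 k) :
    y0 (act (upper S hS).1 x) = y0 x := by
  simp only [upper, y0_eq, tens_act, sum_fromBlocks_inr, sum_one_mul, sum_zero_mul]
  simp

theorem matB_act_upper {S : Matrix (Fin 3) (Fin 3) k} (hS : S.IsSymm) (x : Wedge3 k) :
    matB (act (upper S hS).1 x) = matB x - y0 x • S := by
  ext i j
  fin_cases j <;> fin_cases i <;>
    simp only [Fin.reduceFinMk, Fin.zero_eta, upper, matB_col0, matB_col1, matB_col2, tens_act,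
      sum_fromBlocks_inl, sum_fromBlocks_inr, sum_one_mul, sum_zero_mul, Matrix.sub_apply] <;>
    simp [Fin.sum_univ_three] <;> ring

theorem matA_act_upper {S : Matrix (Fin 3) (Fin 3) k} (hS : S.IsSymm) {x : Wedge3 k}
    (hx : x ∈ X k) :
    matA (act (upper S hS).1 x) =
      matA x + ((matB x + S).adjugate - (matB x).adjugate - S.adjugate) - y0 x • S.adjugate := by
  obtain ⟨hA, hB⟩ := (mem_X_iff x).mp hx
  ext i j
  fin_cases j <;> fin_cases i <;>
    simp only [Fin.reduceFinMk, Fin.zero_eta, upper, matA_col0, matA_col1, matA_col2, tens_act,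
      sum_fromBlocks_inl, sum_fromBlocks_inr, sum_one_mul, sum_zero_mul, Matrix.sub_apply,
      Matrix.add_apply] <;>
    simp [Fin.sum_univ_three, adjugate_fin_three,
      hA.apply 0 1, hA.apply 0 2, hA.apply 1 2, hB.apply 0 1, hB.apply 0 2, hB.apply 1 2,
      hS.apply 0 1, hS.apply 0 2, hS.apply 1 2] <;>
    ring

theorem quarticJ_act_upper (h2 : (2 : k) ≠ 0) {S : Matrix (Fin 3) (Fin 3) k} (hS : S.IsSymm)
    {x : Wedge3 k} (hx : x ∈ X k) : quarticJ (act (upper S hS).1 x) = quarticJ x := by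
  have h4 : (4 : k) ≠ 0 := by
    rw [show (4 : k) = 2 * 2 by norm_num]; exact mul_ne_zero h2 h2
  refine mul_left_cancel₀ h4 ?_
  rw [quarticJ_eq h2 hx, quarticJ_eq h2 (act_mem_X _ hx)]
  refine Eq.trans ?_ (quarticPoly_upper _ _ _ _ _ _ _ _ _ _ _ _ _ _
    (S 0 0) (S 0 1) (S 0 2) (S 1 1) (S 1 2) (S 2 2))
  rw [x0_act_upper hS hx, y0_act_upper, matA_act_upper hS hx, matB_act_upper]
  obtain ⟨hA, hB⟩ := (mem_X_iff x).mp hx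
  congr 1 <;>
  simp [Fin.sum_univ_three, trace_fin_three, mul_apply, det_fin_three, adjugate_fin_three,
    hA.apply 0 1, hA.apply 0 2, hA.apply 1 2, hB.apply 0 1, hB.apply 0 2, hB.apply 1 2,
    hS.apply 0 1, hS.apply 0 2, hS.apply 1 2] <;>
  ring

theorem quarticJ_act_J (x : Wedge3 k) : quarticJ (act (J (Fin 3) k) x) = quarticJ x := by
  rw [quarticJ, quarticJ, x0_act_J, y0_act_J, matA_act_J, matB_act_J]
  have : (-matA x).adjugate = (matA x).adjugate := by
    rw [← neg_one_smul k, adjugate_smul]; simp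
  rw [this, det_neg, trace_mul_comm (matB x).adjugate, Matrix.mul_neg, trace_neg,
    trace_mul_comm (matB x)]
  simp
  ring

/-- Treating `P` as an independent matrix keeps the formulas polynomial in the entries. The case `A
= 0` suffices because Levi elements are applied only after `A` has been removed or moved into `B` by
`J`. -/
theorem levi_formulas (h P : Matrix (Fin 3) (Fin 3) k) (hP : hᵀ * P = 1) {x : Wedge3 k}
    (hA : matA x = 0) :
    x0 (act (levi h P hP).1 x) = h.det * x0 x ∧ y0 (act (levi h P hP).1 x) = P.det * y0 x ∧
    matA (act (levi h P hP).1 x) = 0 ∧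
    matB (act (levi h P hP).1 x) = h * matB x * P.adjugate := by
  refine ⟨?_, ?_, ?_, ?_⟩
  · simp only [levi, x0_eq x, x0_eq (act _ x), tens_act, sum_fromBlocks_inl, sum_zero_mul]
    simp [Fin.sum_univ_three, det_fin_three]
    ring
  · simp only [levi, y0_eq x, y0_eq (act _ x), tens_act, sum_fromBlocks_inr, sum_zero_mul]
    simp [Fin.sum_univ_three, det_fin_three]
    ring
  · ext i j
    fin_cases j <;>
      simp only [Fin.reduceFinMk, Fin.zero_eta, levi, matA_col0, matA_col1, matA_col2, tens_act,
        sum_fromBlocks_inl, sum_fromBlocks_inr, sum_zero_mul] <;>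
      simp [Fin.sum_univ_three, hA]
  · ext i j
    fin_cases j <;>
      simp only [Fin.reduceFinMk, Fin.zero_eta, levi, matB_col0, matB_col1, matB_col2, tens_act,
        sum_fromBlocks_inl, sum_fromBlocks_inr, sum_zero_mul] <;>
      simp [Fin.sum_univ_three, mul_apply, adjugate_fin_three] <;>
      ring

theorem adjugate_of_transpose_mul {h P : Matrix (Fin 3) (Fin 3) k} (hP : hᵀ * P = 1) :
    P.adjugate = P.det • hᵀ := by
  calc P.adjugate = hᵀ * P * P.adjugate := by rw [hP, Matrix.one_mul]
    _ = P.det • hᵀ := by rw [Matrix.mul_assoc, mul_adjugate, Matrix.mul_smul, Matrix.mul_one]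

/-! ### Orbits -/

theorem mem_spOrbit_self (x : Wedge3 k) : x ∈ spOrbit x := ⟨1, (act_one x).symm⟩

theorem spOrbit_trans {x y z : Wedge3 k} (hy : y ∈ spOrbit x) (hz : z ∈ spOrbit y) :
    z ∈ spOrbit x := by
  obtain ⟨g, rfl⟩ := hy
  obtain ⟨h, rfl⟩ := hz
  exact ⟨h * g, (act_mul _ _ _).symm⟩

theorem act_inv_act (g : Sp6 k) (x : Wedge3 k) : act (g⁻¹).1 (act g.1 x) = x := by
  rw [← act_mul, ← Submonoid.coe_mul, inv_mul_cancel, Submonoid.coe_one, act_one]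

theorem spOrbit_symm {x y : Wedge3 k} (hy : y ∈ spOrbit x) : x ∈ spOrbit y := by
  obtain ⟨g, rfl⟩ := hy
  exact ⟨g⁻¹, (act_inv_act g x).symm⟩

theorem mem_X_of_mem_spOrbit {x y : Wedge3 k} (hy : y ∈ spOrbit x) (hx : x ∈ X k) : y ∈ X k := by
  obtain ⟨g, rfl⟩ := hy
  exact act_mem_X g hx

theorem act_J_mem (x : Wedge3 k) : act (J (Fin 3) k) x ∈ spOrbit x :=
  ⟨⟨_, SymplecticGroup.J_mem _ _⟩, rfl⟩

theorem act_upper_mem {S : Matrix (Fin 3) (Fin 3) k} (hS : S.IsSymm) (x : Wedge3 k) :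
    act (upper S hS).1 x ∈ spOrbit x := ⟨_, rfl⟩

/-! ### The normal forms in coordinates -/

theorem wedge_tens (u v w : V k) (i j l) : tens (wedge u v w) i j l =
      u i * v j * w l - u i * v l * w j - u j * v i * w l
        + u j * v l * w i + u l * v i * w j - u l * v j * w i := by
  simp [wedge, tens_ιMulti]

theorem rep1_blocks : x0 (rep1 k) = 1 ∧ matA (rep1 k) = 0 ∧ matB (rep1 k) = 0 ∧
    y0 (rep1 k) = 0 := by
  refine ⟨?_, ?_, ?_, ?_⟩
  · (simp only [Fin.reduceFinMk, Fin.zero_eta, x0_eq, rep1, tens_add, tens_smul, tens_neg, wedge_tens]; simp [e])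
  · ext i j
    fin_cases j <;> (simp only [Fin.reduceFinMk, Fin.zero_eta, matA_col0, matA_col1, matA_col2, rep1, tens_add, tens_smul, tens_neg, wedge_tens]; simp [e])
  · ext i j
    fin_cases j <;> (simp only [Fin.reduceFinMk, Fin.zero_eta, matB_col0, matB_col1, matB_col2, rep1, tens_add, tens_smul, tens_neg, wedge_tens]; simp [e])
  · (simp only [Fin.reduceFinMk, Fin.zero_eta, y0_eq, rep1, tens_add, tens_smul, tens_neg, wedge_tens]; simp [e])

theorem rep2_blocks (a : k) : x0 (rep2 a) = 1 ∧ matA (rep2 a) = 0 ∧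
    matB (rep2 a) = diagonal ![a, 0, 0] ∧ y0 (rep2 a) = 0 := by
  refine ⟨?_, ?_, ?_, ?_⟩
  · (simp only [Fin.reduceFinMk, Fin.zero_eta, x0_eq, rep2, tens_add, tens_smul, tens_neg, wedge_tens]; simp [e])
  · ext i j
    fin_cases j <;> (simp only [Fin.reduceFinMk, Fin.zero_eta, matA_col0, matA_col1, matA_col2, rep2, tens_add, tens_smul, tens_neg, wedge_tens]; simp [e])
  · ext i j
    fin_cases j <;> fin_cases i <;>
      (simp only [Fin.reduceFinMk, Fin.zero_eta, matB_col0, matB_col1, matB_col2, rep2, tens_add, tens_smul, tens_neg, wedge_tens]; simp [e])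
  · (simp only [Fin.reduceFinMk, Fin.zero_eta, y0_eq, rep2, tens_add, tens_smul, tens_neg, wedge_tens]; simp [e])

theorem rep4_blocks (a b c : k) : x0 (rep4 a b c) = 0 ∧ matA (rep4 a b c) = diagonal ![a, b, c] ∧
    matB (rep4 a b c) = 0 ∧ y0 (rep4 a b c) = 0 := by
  refine ⟨?_, ?_, ?_, ?_⟩
  · (simp only [Fin.reduceFinMk, Fin.zero_eta, x0_eq, rep4, tens_add, tens_smul, tens_neg, wedge_tens]; simp [e])
  · ext i j
    fin_cases j <;> fin_cases i <;>
      (simp only [Fin.reduceFinMk, Fin.zero_eta, matA_col0, matA_col1, matA_col2, rep4, tens_add, tens_smul, tens_neg, wedge_tens]; simp [e])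
  · ext i j
    fin_cases j <;> fin_cases i <;>
      (simp only [Fin.reduceFinMk, Fin.zero_eta, matB_col0, matB_col1, matB_col2, rep4, tens_add, tens_smul, tens_neg, wedge_tens]; simp [e])
  · (simp only [Fin.reduceFinMk, Fin.zero_eta, y0_eq, rep4, tens_add, tens_smul, tens_neg, wedge_tens]; simp [e])

theorem ne_zero_of_x0_ne_zero {x : Wedge3 k} (h : x0 x ≠ 0) : x ≠ 0 := by
  rintro rfl; simp [x0] at h

theorem rep1_mem : rep1 k ∈ nonzeroNullCone k := by
  obtain ⟨h1, h2, h3, h4⟩ := rep1_blocks (k := k)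
  refine ⟨?_, ?_, ne_zero_of_x0_ne_zero (by simp [h1])⟩
  · rw [mem_X_iff, h2, h3]; simp
  · simp [quarticJ, h1, h2, h3, h4]

theorem rep2_mem (a : k) : rep2 a ∈ nonzeroNullCone k := by
  obtain ⟨h1, h2, h3, h4⟩ := rep2_blocks a
  refine ⟨?_, ?_, ne_zero_of_x0_ne_zero (by simp [h1])⟩
  · rw [mem_X_iff, h2, h3]; simp
  · simp [quarticJ, h1, h2, h3, h4, Fin.prod_univ_three]

theorem rep4_mem {a : k} (ha : a ≠ 0) (b c : k) : rep4 a b c ∈ nonzeroNullCone k := by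
  obtain ⟨h1, h2, h3, h4⟩ := rep4_blocks a b c
  refine ⟨?_, ?_, ?_⟩
  · rw [mem_X_iff, h2, h3]; simp
  · simp [quarticJ, h1, h2, h3, h4]
  · intro h
    have : matA (rep4 a b c) 0 0 = 0 := by rw [h]; simp [matA]
    rw [h2] at this
    exact ha (by simpa using this)

/-! ### Reduction to normal form -/

/-- Polarisation: with 2 invertible, a symmetric form vanishing on the diagonal is zero. -/
theorem exists_dotProduct_ne_zero (h2 : (2 : k) ≠ 0) {A : Matrix (Fin 3) (Fin 3) k}
    (hA : A.IsSymm) (h : A ≠ 0) : ∃ v : Fin 3 → k, v ⬝ᵥ A *ᵥ v ≠ 0 := by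
  by_contra! hv
  refine h ?_
  have key : ∀ i j, A i j = 0 := by
    intro i j
    have h1 := hv (Pi.single i 1)
    have h3 := hv (Pi.single j 1)
    have h4 := hv (Pi.single i 1 + Pi.single j 1)
    simp only [mulVec_add, add_dotProduct, dotProduct_add, h1, h3, single_dotProduct,
      mulVec_single_one, one_mul, col_apply, hA.apply i j] at h4
    simp only [single_dotProduct, mulVec_single_one, one_mul, col_apply] at h1 h3
    have : (2 : k) * A i j = 0 := by linear_combination h4 - h1 - h3
    exact (mul_eq_zero.mp this).resolve_left h2
  ext i j; exact key i j

theorem adjugate_vecMulVec_fin_three (v : Fin 3 → k) : (vecMulVec v v).adjugate = 0 := by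
  ext i j
  fin_cases i <;> fin_cases j <;> simp [adjugate_fin_three, vecMulVec_apply] <;> ring

/-- Elements of the null cone are conjugate to elements with `x₀ ≠ 0`. -/
theorem exists_x0_ne_zero (h2 : (2 : k) ≠ 0) {x : Wedge3 k} (hx : x ∈ X k) (hne : x ≠ 0) :
    ∃ y ∈ spOrbit x, quarticJ y = quarticJ x ∧ x0 y ≠ 0 := by
  have hmain : ∀ x : Wedge3 k, x ∈ X k → matA x ≠ 0 → y0 x = 0 → x0 x = 0 →
      ∃ y ∈ spOrbit x, quarticJ y = quarticJ x ∧ x0 y ≠ 0 := by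
    intro x hx hA hy0 hx0
    obtain ⟨v, hv⟩ := exists_dotProduct_ne_zero h2 ((mem_X_iff x).mp hx).1 hA
    -- For `S = v vᵀ` the adjugate vanishes, so with `x₀ = y₀ = 0` the new `x₀` is `-vᵀ A v`.
    have hS : (vecMulVec v v).IsSymm := by ext i j; simp [vecMulVec_apply, mul_comm]
    refine ⟨_, act_upper_mem hS x, quarticJ_act_upper h2 hS hx, ?_⟩
    rw [x0_act_upper hS hx, hx0, hy0, adjugate_vecMulVec_fin_three, mul_vecMulVec,
      trace_vecMulVec]
    simpa [dotProduct_comm] using hv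
  by_cases h0 : x0 x = 0
  swap
  · exact ⟨x, mem_spOrbit_self x, rfl, h0⟩
  by_cases h1 : y0 x = 0
  swap
  · exact ⟨_, act_J_mem x, quarticJ_act_J x, by rw [x0_act_J]; exact neg_ne_zero.mpr h1⟩
  by_cases hA : matA x = 0
  swap
  · exact hmain x hx hA h1 h0
  have hB : matB x ≠ 0 := fun hB => hne (eq_zero_of_blocks x h0 hA hB h1)
  obtain ⟨y, hy, hJ, hy0⟩ := hmain _ (mem_X_of_mem_spOrbit (act_J_mem x) hx)
    (by rwa [matA_act_J]) (by rw [y0_act_J, h0]) (by rw [x0_act_J, h1, neg_zero])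
  exact ⟨y, spOrbit_trans (act_J_mem x) hy, hJ.trans (quarticJ_act_J x), hy0⟩

/-- The action of the opposite unipotent elements. -/
theorem exists_lower (h2 : (2 : k) ≠ 0) {T : Matrix (Fin 3) (Fin 3) k} (hT : T.IsSymm)
    {x : Wedge3 k} (hx : x ∈ X k) :
    ∃ y ∈ spOrbit x, quarticJ y = quarticJ x ∧ x0 y = x0 x ∧ matA y = matA x - x0 x • T ∧
      (matA x = 0 → matB y = matB x - x0 x • T.adjugate ∧
        y0 y = y0 x - (matB x * T).trace + x0 x * T.det) := by
  -- On the group, `J² = -1`, so three applications of `J` give its inverse and the element used is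
  -- `J · upper(-T) · J⁻¹`, an opposite unipotent.
  let w := act (J (Fin 3) k) (act (J (Fin 3) k) (act (J (Fin 3) k) x))
  have hw : w ∈ spOrbit x :=
    spOrbit_trans (spOrbit_trans (act_J_mem x) (act_J_mem _)) (act_J_mem _)
  have hwX := mem_X_of_mem_spOrbit hw hx
  have hT' : (-T).IsSymm := hT.neg
  have w1 : x0 w = y0 x := by simp only [w, x0_act_J, y0_act_J, neg_neg]
  have w2 : y0 w = -x0 x := by simp only [w, x0_act_J, y0_act_J]
  have w3 : matA w = -matB x := by simp only [w, matA_act_J, matB_act_J]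
  have w4 : matB w = matA x := by simp only [w, matA_act_J, matB_act_J, neg_neg]
  have hadj : (-T).adjugate = T.adjugate := by
    rw [← neg_one_smul k, adjugate_smul]; simp
  refine ⟨_, spOrbit_trans hw (spOrbit_trans (act_upper_mem hT' w) (act_J_mem _)), ?_, ?_, ?_, ?_⟩
  · rw [quarticJ_act_J, quarticJ_act_upper h2 hT' hwX]
    simp only [w, quarticJ_act_J]
  · rw [x0_act_J, y0_act_upper, w2, neg_neg]
  · rw [matA_act_J, matB_act_upper, w2, w4]; simp [sub_eq_add_neg]
  · intro hA
    rw [matB_act_J, y0_act_J, matA_act_upper hT' hwX, x0_act_upper hT' hwX, w1, w2, w3, w4, hA,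
      zero_add, hadj, det_neg]
    constructor
    · simp [adjugate_zero]
      abel
    · simp
      ring

/-- The rows of `P` are an orthogonal basis for the bilinear form of `A`; the diagonal form may be
degenerate. -/
theorem exists_diagonal (h2 : (2 : k) ≠ 0) {A : Matrix (Fin 3) (Fin 3) k} (hA : A.IsSymm) :
    ∃ (P : Matrix (Fin 3) (Fin 3) k) (d : Fin 3 → k), P.det ≠ 0 ∧ P * A * Pᵀ = diagonal d := by
  have : Invertible (2 : k) := invertibleOfNonzero h2
  obtain ⟨v, hv⟩ := LinearMap.BilinForm.exists_orthogonal_basis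
    (B := Matrix.toBilin' A) ⟨fun x y => (Matrix.isSymm_toBilin'_iff_isSymm.mpr hA).eq x y⟩
  let b := v.reindex (finCongr (by simp : Module.finrank k (Fin 3 → k) = 3))
  have hb : ∀ i j, i ≠ j → Matrix.toBilin' A (b i) (b j) = 0 := by
    intro i j hij
    have : ∀ i, b i = v ((finCongr (by simp)).symm i) := fun i => v.reindex_apply _ _
    rw [this, this]
    exact hv (by simpa using hij)
  refine ⟨Matrix.of fun i => b i, fun i => Matrix.toBilin' A (b i) (b i), ?_, ?_⟩
  · have h : LinearIndependent k (Matrix.of fun i => b i).row := b.linearIndependent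
    rw [Matrix.linearIndependent_rows_iff_isUnit, Matrix.isUnit_iff_isUnit_det] at h
    exact h.ne_zero
  · have key : ∀ i j, ((Matrix.of fun i => b i) * A * (Matrix.of fun i => b i)ᵀ) i j =
        Matrix.toBilin' A (b i) (b j) := by
      intro i j
      rw [Matrix.toBilin'_apply', Matrix.mul_assoc]
      rfl
    ext i j
    rw [key, diagonal_apply]
    split_ifs with h
    · rw [h]
    · exact hb i j h

/-- The inverse transpose acts on the second half of the basis. The twist `det(h)⁻¹` on `B` comes
from the adjugate of that matrix and is what later absorbs scalars. -/
theorem exists_levi {h : Matrix (Fin 3) (Fin 3) k} (hh : h.det ≠ 0) {x : Wedge3 k}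
    (hA : matA x = 0) :
    ∃ y ∈ spOrbit x, x0 y = h.det * x0 x ∧ y0 y = h.det⁻¹ * y0 x ∧ matA y = 0 ∧
      matB y = h.det⁻¹ • (h * matB x * hᵀ) := by
  have hu : IsUnit h.det := hh.isUnit
  have hP : hᵀ * (h⁻¹)ᵀ = 1 := by
    rw [← transpose_mul, nonsing_inv_mul _ hu, transpose_one]
  have hd : ((h⁻¹)ᵀ).det = h.det⁻¹ := by
    rw [det_transpose, det_nonsing_inv, Ring.inverse_eq_inv']
  obtain ⟨h1, h2, h3, h4⟩ := levi_formulas h _ hP hA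
  refine ⟨_, ⟨_, rfl⟩, h1, ?_, h3, ?_⟩
  · rw [h2, hd]
  · rw [h4, adjugate_of_transpose_mul hP, hd, Matrix.mul_smul]

/-- The normal form of an orbit with `A = 0`, `B` nondegenerate and `x₀ = y₀ = 0`. -/
theorem exists_rep4_of_matB (h2 : (2 : k) ≠ 0) {x : Wedge3 k} (hx : x ∈ X k) (h0 : x0 x = 0)
    (h1 : y0 x = 0) (hA : matA x = 0) (hB : (matB x).det ≠ 0) :
    ∃ a b c : k, a ≠ 0 ∧ b ≠ 0 ∧ c ≠ 0 ∧ rep4 a b c ∈ spOrbit x := by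
  obtain ⟨P, d, hP, hd⟩ := exists_diagonal h2 ((mem_X_iff x).mp hx).2
  obtain ⟨y, hy, y1, y2, y3, y4⟩ := exists_levi hP hA
  rw [hd] at y4
  have hprod : ∀ i, d i ≠ 0 := by
    have h := congrArg Matrix.det hd
    rw [det_mul, det_mul, det_transpose, det_diagonal] at h
    intro i
    refine Finset.prod_ne_zero_iff.mp ?_ i (Finset.mem_univ i)
    rw [← h]
    exact mul_ne_zero (mul_ne_zero hP hB) hP
  have hP' := inv_ne_zero hP
  refine ⟨P.det⁻¹ * d 0, P.det⁻¹ * d 1, P.det⁻¹ * d 2, mul_ne_zero hP' (hprod 0),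
    mul_ne_zero hP' (hprod 1), mul_ne_zero hP' (hprod 2), ?_⟩
  have : rep4 (P.det⁻¹ * d 0) (P.det⁻¹ * d 1) (P.det⁻¹ * d 2) = act (J (Fin 3) k) y := by
    obtain ⟨r1, r2, r3, r4⟩ := rep4_blocks (P.det⁻¹ * d 0) (P.det⁻¹ * d 1) (P.det⁻¹ * d 2)
    refine ext_blocks ?_ ?_ ?_ ?_
    · rw [r1, x0_act_J, y2, h1]; simp
    · rw [r2, matA_act_J, y4, ← diagonal_smul]
      congr 1
      funext i
      fin_cases i <;> simp
    · rw [r3, matB_act_J, y3, neg_zero]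
    · rw [r4, y0_act_J, y1, h0]; simp
  rw [this]
  exact spOrbit_trans hy (act_J_mem y)

/-- The normal form of an orbit with `A = 0`, `y₀ ≠ 0` and `x₀ ≠ 0`. -/
theorem exists_rep4_of_y0_ne_zero (h2 : (2 : k) ≠ 0) {x : Wedge3 k} (hx : x ∈ X k)
    (h0 : x0 x ≠ 0) (h1 : y0 x ≠ 0) (hA : matA x = 0)
    (hB : 4 * (matB x).det = x0 x * y0 x ^ 2) :
    ∃ a b c : k, a ≠ 0 ∧ b ≠ 0 ∧ c ≠ 0 ∧ rep4 a b c ∈ spOrbit x := by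
  have hBs := ((mem_X_iff x).mp hx).2
  have hdet : (matB x).det ≠ 0 := by
    intro h
    rw [h, mul_zero] at hB
    exact mul_ne_zero h0 (pow_ne_zero 2 h1) hB.symm
  set B := matB x with hBdef
  have hadj : B.adjugate.IsSymm := by
    rw [IsSymm, adjugate_transpose, hBs.eq]
  -- The constant is chosen so that `T = c B^#` satisfies `x₀ T^# = B`: this says `x₀ c² det B = 1`,
  -- which is `4 det B = x₀ y₀²`. The same `T` then also kills `y₀`.
  set c : k := 2 / (x0 x * y0 x) with hc
  have hcx : c * (x0 x * y0 x) = 2 := by rw [hc]; field_simp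
  have hcne : c ≠ 0 := by rw [hc]; positivity
  have hT : (c • B.adjugate).IsSymm := hadj.smul c
  have hTadj : (c • B.adjugate).adjugate = (c ^ 2 * B.det) • B := by
    rw [adjugate_smul, adjugate_adjugate _ (by simp)]
    simp [smul_smul]
  have hTdet : (c • B.adjugate).det = c ^ 3 * B.det ^ 2 := by
    rw [det_smul, det_adjugate]; simp
  have hTtr : (B * (c • B.adjugate)).trace = c * (3 * B.det) := by
    rw [Matrix.mul_smul, trace_smul, mul_adjugate, trace_smul, trace_one]
    simp only [Fintype.card_fin, smul_eq_mul]
    push_cast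
    ring
  obtain ⟨y, hy, -, y1, y2, y3⟩ := exists_lower h2 hT hx
  obtain ⟨y4, y5⟩ := y3 hA
  have e1 : x0 x * (c ^ 2 * B.det) = 1 := by
    have h4 : (4 : k) ≠ 0 := by
      rw [show (4 : k) = 2 * 2 by norm_num]; exact mul_ne_zero h2 h2
    refine mul_left_cancel₀ h4 ?_
    linear_combination (x0 x * c ^ 2) * hB + (c * (x0 x * y0 x) + 2) * hcx
  have y4' : matB y = 0 := by
    rw [y4, hTadj, smul_smul, e1, one_smul, sub_self]
  have y5' : y0 y = 0 := by
    rw [y5, hTtr, hTdet]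
    refine (mul_eq_zero.mp (?_ : (2 : k) * _ = 0)).resolve_left h2
    linear_combination (2 * c * B.det) * e1 - c * hB - y0 x * hcx
  have hyX := mem_X_of_mem_spOrbit hy hx
  rw [hA, zero_sub] at y2
  have hAdet : (matA y).det ≠ 0 := by
    rw [y2, det_neg, det_smul, hTdet]
    simp [h0, hcne, hdet]
  have hAne : matA y ≠ 0 := by
    intro h; rw [h] at hAdet; simp at hAdet
  obtain ⟨v, hv⟩ := exists_dotProduct_ne_zero h2 ((mem_X_iff y).mp hyX).1 hAne
  -- With `B = 0` and `y₀ = 0`, a unipotent changes only `x₀`, by `-tr(A S)`; this multiple of `v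
  -- vᵀ` has `tr(A S) = x₀`.
  have hS : ((x0 x / (v ⬝ᵥ matA y *ᵥ v)) • vecMulVec v v).IsSymm := by
    ext i j; simp [vecMulVec_apply, mul_comm]
  set z := act (upper _ hS).1 y with hz
  have hzy : z ∈ spOrbit y := act_upper_mem hS y
  have z1 : x0 z = 0 := by
    rw [hz, x0_act_upper hS hyX, y4', y5', Matrix.mul_smul, trace_smul, mul_vecMulVec,
      trace_vecMulVec, y1, dotProduct_comm (matA y *ᵥ v)]
    simp [hv]
  have z2 : y0 z = 0 := by rw [hz, y0_act_upper, y5']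
  have z3 : matB z = 0 := by rw [hz, matB_act_upper, y4', y5']; simp
  have z4 : matA z = matA y := by rw [hz, matA_act_upper hS hyX, y4', y5']; simp
  have hw := act_J_mem z
  obtain ⟨a, b, c, ha, hb, hc, hr⟩ := exists_rep4_of_matB h2
    (mem_X_of_mem_spOrbit hw (mem_X_of_mem_spOrbit hzy hyX))
    (by rw [x0_act_J, z2, neg_zero]) (by rw [y0_act_J, z1]) (by rw [matA_act_J, z3])
    (by rw [matB_act_J, z4, det_neg]; simpa using hAdet)
  exact ⟨a, b, c, ha, hb, hc, spOrbit_trans (spOrbit_trans (spOrbit_trans hy hzy) hw) hr⟩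

theorem exists_cycle {x : Wedge3 k} (hA : matA x = 0) {a b c : k}
    (hB : matB x = diagonal ![a, b, c]) :
    ∃ y ∈ spOrbit x, x0 y = x0 x ∧ y0 y = y0 x ∧ matA y = 0 ∧ matB y = diagonal ![b, c, a] := by
  -- A cyclic permutation is even, so it has determinant 1 and moves the diagonal without rescaling
  -- it.
  let h : Matrix (Fin 3) (Fin 3) k := !![0, 1, 0; 0, 0, 1; 1, 0, 0]
  have hd : h.det = 1 := by simp [h, det_fin_three]
  obtain ⟨y, hy, y1, y2, y3, y4⟩ := exists_levi (h := h) (by simp [hd]) hA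
  refine ⟨y, hy, by simp [y1, hd], by simp [y2, hd], y3, ?_⟩
  rw [y4, hd, hB]
  ext i j
  simp only [Matrix.smul_apply, mul_apply, Fin.sum_univ_three, transpose_apply]
  fin_cases i <;> fin_cases j <;> simp [h, diagonal_apply]

/-- The normal form of an orbit with `A = 0`, `B` diagonal of rank at most two, `y₀ = 0` and
`x₀ = 1`. -/
theorem exists_rep_of_diagonal {x : Wedge3 k} (h0 : x0 x = 1) (h1 : y0 x = 0) (hA : matA x = 0)
    {a b : k} (hB : matB x = diagonal ![a, b, 0]) :
    rep1 k ∈ spOrbit x ∨ (∃ a : k, a ≠ 0 ∧ rep2 a ∈ spOrbit x) ∨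
      (∃ a b c : k, a ≠ 0 ∧ b ≠ 0 ∧ c ≠ 0 ∧ rep4 a b c ∈ spOrbit x) := by
  have hrep2 : ∀ {y : Wedge3 k} {c : k}, x0 y = 1 → y0 y = 0 → matA y = 0 →
      matB y = diagonal ![c, 0, 0] → y = rep2 c := by
    intro y c y1 y2 y3 y4
    obtain ⟨r1, r2, r3, r4⟩ := rep2_blocks c
    exact ext_blocks (y1.trans r1.symm) (y3.trans r2.symm) (y4.trans r3.symm) (y2.trans r4.symm)
  by_cases hb : b = 0
  · subst hb
    by_cases ha : a = 0
    · subst ha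
      left
      obtain ⟨r1, r2, r3, r4⟩ := rep1_blocks (k := k)
      have : rep1 k = x := by
        refine ext_blocks (r1.trans h0.symm) (r2.trans hA.symm) ?_ (r4.trans h1.symm)
        rw [r3, hB]
        ext i j
        fin_cases i <;> fin_cases j <;> simp
      rw [this]
      exact mem_spOrbit_self x
    · right; left
      exact ⟨a, ha, hrep2 h0 h1 hA hB ▸ mem_spOrbit_self x⟩
  · by_cases ha : a = 0
    · subst ha
      obtain ⟨y, hy, y1, y2, y3, y4⟩ := exists_cycle hA hB
      right; left
      exact ⟨b, hb, hrep2 (y1.trans h0) (y2.trans h1) y3 y4 ▸ hy⟩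
    · right; right
      refine ⟨-b, -a, -1, neg_ne_zero.mpr hb, neg_ne_zero.mpr ha, by simp, ?_⟩
      -- This element sends `e₃ ↦ e₆`, `e₆ ↦ -e₃` and fixes the other basis vectors. It takes
      -- `-e₁e₂e₃ + a e₁e₅e₆ + b e₄e₂e₆` to `-b e₄e₂e₃ - a e₁e₅e₃ - e₁e₂e₆`.
      let g : Sp6 k := ⟨fromBlocks (diagonal ![1, 1, 0]) (diagonal ![0, 0, -1])
        (diagonal ![0, 0, 1]) (diagonal ![1, 1, 0]), by
          rw [SymplecticGroup.fromBlocks_mem_iff]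
          simp only [diagonal_transpose, diagonal_mul_diagonal, diagonal_sub, ← diagonal_one,
            true_and, diagonal_eq_diagonal_iff, Fin.forall_fin_succ]
          simp⟩
      have hsum : ∀ (d : Fin 3 → k) (i : Fin 3) (f : Fin 3 → k),
          ∑ a, diagonal d i a * f a = d i * f i := by
        intro d i f
        simp [diagonal_apply]
      refine ⟨g, ?_⟩
      obtain ⟨r1, r2, r3, r4⟩ := rep4_blocks (-b) (-a) (-1 : k)
      refine ext_blocks ?_ ?_ ?_ ?_
      · rw [r1]
        simp only [g, x0_eq, tens_act, sum_fromBlocks_inl, hsum]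
        simp [hA]
      · rw [r2]
        ext i j
        fin_cases j <;> fin_cases i <;>
          simp only [Fin.reduceFinMk, Fin.zero_eta, g, matA_col0, matA_col1, matA_col2, tens_act,
            sum_fromBlocks_inl, sum_fromBlocks_inr, hsum] <;>
          simp [hA, hB, h0, h1]
      · rw [r3]
        ext i j
        fin_cases j <;> fin_cases i <;>
          simp only [Fin.reduceFinMk, Fin.zero_eta, g, matB_col0, matB_col1, matB_col2, tens_act,
            sum_fromBlocks_inl, sum_fromBlocks_inr, hsum] <;>
          simp [hA, hB, h0, h1]
      · rw [r4]
        simp only [g, y0_eq, tens_act, sum_fromBlocks_inr, hsum]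
        simp [hB]

theorem exists_rep_mem_spOrbit (h2 : (2 : k) ≠ 0) {x : Wedge3 k} (hx : x ∈ nonzeroNullCone k) :
    rep1 k ∈ spOrbit x ∨ (∃ a : k, a ≠ 0 ∧ rep2 a ∈ spOrbit x) ∨
      (∃ a b c : k, a ≠ 0 ∧ b ≠ 0 ∧ c ≠ 0 ∧ rep4 a b c ∈ spOrbit x) := by
  have htrans : ∀ {x y : Wedge3 k}, y ∈ spOrbit x →
      (rep1 k ∈ spOrbit y ∨ (∃ a : k, a ≠ 0 ∧ rep2 a ∈ spOrbit y) ∨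
        (∃ a b c : k, a ≠ 0 ∧ b ≠ 0 ∧ c ≠ 0 ∧ rep4 a b c ∈ spOrbit y)) →
      (rep1 k ∈ spOrbit x ∨ (∃ a : k, a ≠ 0 ∧ rep2 a ∈ spOrbit x) ∨
        (∃ a b c : k, a ≠ 0 ∧ b ≠ 0 ∧ c ≠ 0 ∧ rep4 a b c ∈ spOrbit x)) := by
    rintro x y hy (h | ⟨a, ha, h⟩ | ⟨a, b, c, ha, hb, hc, h⟩)
    · exact Or.inl (spOrbit_trans hy h)
    · exact Or.inr (Or.inl ⟨a, ha, spOrbit_trans hy h⟩)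
    · exact Or.inr (Or.inr ⟨a, b, c, ha, hb, hc, spOrbit_trans hy h⟩)
  obtain ⟨hX, hJ, hne⟩ := hx
  obtain ⟨y, hy, yJ, y0ne⟩ := exists_x0_ne_zero h2 hX hne
  refine htrans hy ?_
  have hyX := mem_X_of_mem_spOrbit hy hX
  have hyA := ((mem_X_iff y).mp hyX).1
  -- The choice `T = x₀⁻¹ A` makes the new `A` vanish.
  obtain ⟨z, hz, zJ, z1, z2, -⟩ := exists_lower h2 (hyA.smul (x0 y)⁻¹) hyX
  refine htrans hz ?_
  have hzX := mem_X_of_mem_spOrbit hz hyX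
  have hzA : matA z = 0 := by rw [z2, smul_smul, mul_inv_cancel₀ y0ne, one_smul, sub_self]
  have hz0 : x0 z ≠ 0 := by rwa [z1]
  -- With `A = 0` the quartic is `x₀ det B - (x₀ y₀)² / 4`; one factor `x₀` cancels.
  have hzdet : 4 * (matB z).det = x0 z * y0 z ^ 2 := by
    have h4 : (4 : k) ≠ 0 := by
      rw [show (4 : k) = 2 * 2 by norm_num]; exact mul_ne_zero h2 h2
    have h : quarticJ z = 0 := by rw [zJ, yJ, hJ]
    rw [quarticJ, hzA] at h
    simp [adjugate_zero] at h
    field_simp at h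
    refine mul_left_cancel₀ hz0 ?_
    linear_combination h
  clear hy yJ y0ne hyX hyA hz zJ z1 z2 hJ hne hX
  by_cases hy0 : y0 z = 0
  swap
  · exact Or.inr (Or.inr (exists_rep4_of_y0_ne_zero h2 hzX hz0 hy0 hzA hzdet))
  have hdet : (matB z).det = 0 := by
    have h4 : (4 : k) ≠ 0 := by
      rw [show (4 : k) = 2 * 2 by norm_num]; exact mul_ne_zero h2 h2
    rw [hy0] at hzdet
    simpa [h4] using hzdet
  obtain ⟨P, d, hP, hd⟩ := exists_diagonal h2 ((mem_X_iff z).mp hzX).2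
  obtain ⟨w, hw, w1, w2, w3, w4⟩ := exists_levi hP hzA
  refine htrans hw ?_
  have hw0 : x0 w ≠ 0 := by rw [w1]; exact mul_ne_zero hP hz0
  -- A diagonal Levi element of determinant `x₀⁻¹` normalises `x₀` to 1 and keeps `B` diagonal.
  let t : Matrix (Fin 3) (Fin 3) k := diagonal ![(x0 w)⁻¹, 1, 1]
  have ht : t.det = (x0 w)⁻¹ := by simp [t, Fin.prod_univ_three]
  obtain ⟨u, hu, u1, u2, u3, u4⟩ := exists_levi (h := t)
    (by rw [ht]; exact inv_ne_zero hw0) w3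
  refine htrans hu ?_
  have hu0 : x0 u = 1 := by rw [u1, ht, inv_mul_cancel₀ hw0]
  have hu1 : y0 u = 0 := by rw [u2, w2, hy0]; simp
  obtain ⟨f, hf⟩ : ∃ f : Fin 3 → k, matB u = diagonal f := by
    rw [u4, w4, hd, ht, ← diagonal_smul, diagonal_transpose, diagonal_mul_diagonal,
      diagonal_mul_diagonal, ← diagonal_smul]
    exact ⟨_, rfl⟩
  have hprod : f 0 * f 1 * f 2 = 0 := by
    have h := congrArg Matrix.det hf
    rw [u4, w4, det_smul, det_mul, det_mul, det_smul, det_mul, det_mul, hdet, det_diagonal,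
      Fin.prod_univ_three] at h
    simpa [Fin.prod_univ_three] using h.symm
  have hf' : f = ![f 0, f 1, f 2] := by funext i; fin_cases i <;> rfl
  rw [hf'] at hf
  rcases mul_eq_zero.mp hprod with h | h
  · rcases mul_eq_zero.mp h with h | h
    · rw [h] at hf
      obtain ⟨v, hv, v1, v2, v3, v4⟩ := exists_cycle u3 hf
      exact htrans hv (exists_rep_of_diagonal (v1.trans hu0) (v2.trans hu1) v3 v4)
    · rw [h] at hf
      obtain ⟨v, hv, v1, v2, v3, v4⟩ := exists_cycle u3 hf
      obtain ⟨v', hv', v1', v2', v3', v4'⟩ := exists_cycle v3 v4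
      exact htrans hv (htrans hv' (exists_rep_of_diagonal (v1'.trans (v1.trans hu0))
        (v2'.trans (v2.trans hu1)) v3' v4'))
  · rw [h] at hf
    exact exists_rep_of_diagonal hu0 hu1 u3 hf

end SixSymplectic

end

noncomputable section

namespace SixSymplectic

open Matrix QuadraticMap

universe u

variable {k : Type u} [Field k]

/-! ### Identities in composition algebras -/

namespace CompositionAlgebra

variable (C : CompositionAlgebra k)

/-- The bilinear form of a composition algebra. -/
abbrev bil (x y : C.carrier) : k := polar C.norm x y

theorem norm_add (x y : C.carrier) : C.norm (x + y) = C.norm x + C.norm y + C.bil x y :=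
  QuadraticMap.map_add C.norm x y

theorem ext_bil {x y : C.carrier} (h : ∀ z, C.bil x z = C.bil y z) : x = y := by
  refine sub_eq_zero.mp (C.nondegenerate.1 (x - y) fun z => ?_)
  rw [QuadraticMap.polarBilin_apply_apply, polar_sub_left, sub_eq_zero]
  exact h z

theorem bil_mul_left (x y z : C.carrier) : C.bil (x * y) (x * z) = C.norm x * C.bil y z := by
  simp only [bil, polar, ← mul_add, C.norm_mul]
  ring

theorem bil_mul_right (x y z : C.carrier) : C.bil (x * z) (y * z) = C.bil x y * C.norm z := by
  simp only [bil, polar, ← add_mul, C.norm_mul]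
  ring

/-- The linearisation of `bil_mul_left` in the left factor. Its special cases with a factor equal to
1 make conjugation the adjoint of multiplication, on either side. -/
theorem bil_mul_mul (x y z w : C.carrier) :
    C.bil (x * y) (z * w) + C.bil (z * y) (x * w) = C.bil x z * C.bil y w := by
  have h := C.bil_mul_left (x + z) y w
  simp only [bil, add_mul, polar_add_left, polar_add_right] at h
  have h1 := C.bil_mul_left x y w
  have h2 := C.bil_mul_left z y w
  rw [C.norm_add] at h
  simp only [bil] at *
  linear_combination h - h1 - h2

/-- The norm of 1 is idempotent, and if it were 0 the norm would vanish identically, against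
nondegeneracy. -/
theorem norm_one : C.norm 1 = 1 := by
  have h := C.norm_mul 1 1
  rw [mul_one] at h
  rcases eq_or_ne (C.norm 1) 0 with h0 | h0
  · exfalso
    have hN : ∀ x, C.norm x = 0 := by
      intro x
      rw [← mul_one x, C.norm_mul, h0, mul_zero]
    refine one_ne_zero (α := C.carrier) (C.ext_bil fun z => ?_)
    simp [bil, polar, hN]
  · exact (mul_left_cancel₀ h0 (by rw [mul_one]; exact h)).symm

/-- The conjugation of a composition algebra. -/
def conj (x : C.carrier) : C.carrier := C.bil x 1 • 1 - x

theorem bil_mul_conj_left (x y w : C.carrier) : C.bil (x * y) w = C.bil y (C.conj x * w) := by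
  have h := C.bil_mul_mul x y 1 w
  rw [one_mul, one_mul] at h
  simp only [conj, sub_mul, smul_mul_assoc, one_mul, bil, polar_sub_right, polar_smul_right,
    smul_eq_mul] at *
  linear_combination h

theorem bil_mul_conj_right (x y w : C.carrier) : C.bil (y * x) w = C.bil y (w * C.conj x) := by
  have h := C.bil_mul_mul y x w 1
  rw [mul_one, mul_one] at h
  simp only [conj, mul_sub, mul_smul_comm, mul_one, bil, polar_sub_right, polar_smul_right,
    smul_eq_mul] at *
  rw [polar_comm _ y (w * x)]
  linear_combination h

/-- Tested against `z`, adjointness turns the left side into `bil (x * y) (x * z)`. This replaces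
associativity in the multiplication tables below. -/
theorem conj_mul_mul (x y : C.carrier) : C.conj x * (x * y) = C.norm x • y := by
  refine C.ext_bil fun z => ?_
  rw [bil, polar_comm, ← bil, ← C.bil_mul_conj_left x z, C.bil_mul_left]
  simp only [bil, polar_smul_left, smul_eq_mul, polar_comm _ y z]

theorem mul_mul_conj (x y : C.carrier) : (y * x) * C.conj x = C.norm x • y := by
  refine C.ext_bil fun z => ?_
  rw [bil, polar_comm, ← bil, ← C.bil_mul_conj_right x z, C.bil_mul_right]
  simp only [bil, polar_smul_left, smul_eq_mul, polar_comm _ y z]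
  ring

theorem conj_mul_self (x : C.carrier) : C.conj x * x = C.norm x • 1 := by
  simpa using C.conj_mul_mul x 1

theorem norm_conj (x : C.carrier) : C.norm (C.conj x) = C.norm x := by
  have h : C.norm (C.bil x 1 • 1 + -x) = C.norm x := by
    rw [C.norm_add, QuadraticMap.map_smul, C.norm_one, QuadraticMap.map_neg]
    simp only [bil, polar_smul_left, polar_neg_right, smul_eq_mul, polar_comm _ 1 x]
    ring
  rwa [← sub_eq_add_neg] at h

theorem mul_self_eq (x : C.carrier) : x * x = C.bil x 1 • x - C.norm x • 1 := by
  have h := C.conj_mul_self x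
  rw [conj, sub_mul, smul_mul_assoc, one_mul] at h
  rw [← h]; abel

variable {C}

theorem conj_of_bil_one {x : C.carrier} (hx : C.bil x 1 = 0) : C.conj x = -x := by
  rw [conj, hx, zero_smul, zero_sub]

theorem mul_mul_of_bil_one {x : C.carrier} (hx : C.bil x 1 = 0) (y : C.carrier) :
    x * (x * y) = -C.norm x • y := by
  have h := C.conj_mul_mul x y
  rw [conj_of_bil_one hx, neg_mul] at h
  rw [neg_smul, ← h, neg_neg]

theorem mul_mul_of_bil_one' {x : C.carrier} (hx : C.bil x 1 = 0) (y : C.carrier) :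
    (y * x) * x = -C.norm x • y := by
  have h := C.mul_mul_conj x y
  rw [conj_of_bil_one hx, mul_neg] at h
  rw [neg_smul, ← h, neg_neg]

theorem mul_self_of_bil_one {x : C.carrier} (hx : C.bil x 1 = 0) : x * x = -C.norm x • 1 := by
  rw [C.mul_self_eq, hx, zero_smul, zero_sub, neg_smul]

/-- Pure elements square to minus their norm; comparing this for `x`, `y` and the pure element `x +
y` leaves the anticommutator equal to 0. -/
theorem mul_comm_of_bil {x y : C.carrier} (hx : C.bil x 1 = 0) (hy : C.bil y 1 = 0)
    (hxy : C.bil x y = 0) : y * x = -(x * y) := by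
  have hs : C.bil (x + y) 1 = 0 := by simp only [bil, polar_add_left] at *; rw [hx, hy, add_zero]
  have h := mul_self_of_bil_one hs
  rw [C.norm_add, hxy, add_mul, mul_add, mul_add, mul_self_of_bil_one hx,
    mul_self_of_bil_one hy, add_zero, neg_add, add_smul] at h
  have h' : x * y + y * x = 0 := by
    have := sub_eq_zero.mpr h
    rw [← this]; abel
  rw [eq_neg_iff_add_eq_zero, add_comm, h']

/-! ### Subalgebras generated by orthogonal elements -/

/-- The linear map from a quadratic algebra determined by a generator. -/
def quadMap (C : CompositionAlgebra k) (a : k) (u : C.carrier) :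
    QuadraticAlgebra k a 0 →ₗ[k] C.carrier where
  toFun q := q.re • 1 + q.im • u
  map_add' p q := by simp only [QuadraticAlgebra.re_add, QuadraticAlgebra.im_add]; module
  map_smul' c q := by
    simp only [QuadraticAlgebra.re_smul, QuadraticAlgebra.im_smul, RingHom.id_apply, smul_eq_mul]
    module

theorem quadMap_mul {u : C.carrier} (hu : C.bil u 1 = 0) {a : k} (ha : C.norm u = -a)
    (p q : QuadraticAlgebra k a 0) :
    quadMap C a u (p * q) = quadMap C a u p * quadMap C a u q := by
  have h := mul_self_of_bil_one hu
  rw [ha, neg_neg] at h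
  simp only [quadMap, LinearMap.coe_mk, AddHom.coe_mk, QuadraticAlgebra.re_mul,
    QuadraticAlgebra.im_mul, add_mul, mul_add, smul_mul_assoc, mul_smul_comm, one_mul, mul_one, h]
  module

theorem quadMap_injective (h2 : (2 : k) ≠ 0) {u : C.carrier} (hu : C.bil u 1 = 0)
    (hN : C.norm u ≠ 0) (a : k) : Function.Injective (quadMap C a u) := by
  refine (injective_iff_map_eq_zero _).mpr fun q hq => ?_
  simp only [quadMap, LinearMap.coe_mk, AddHom.coe_mk] at hq
  have h1 : C.bil (q.re • 1 + q.im • u) 1 = 0 := by rw [hq]; simp [bil]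
  have h3 : C.bil (q.re • 1 + q.im • u) u = 0 := by rw [hq]; simp [bil]
  simp only [bil, polar_add_left, polar_smul_left, polar_self, C.norm_one, smul_eq_mul,
    polar_comm _ 1 u, nsmul_eq_mul] at h1 h3 hu
  rw [hu] at h1 h3
  ext
  · simpa [h2] using h1
  · simpa [h2, hN] using h3

/-- The linear map from a quaternion algebra determined by two generators. -/
def quatMap (C : CompositionAlgebra k) (a b : k) (u v : C.carrier) :
    QuaternionAlgebra k a 0 b →ₗ[k] C.carrier where
  toFun q := q.re • 1 + q.imI • u + q.imJ • v + q.imK • (u * v)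
  map_add' p q := by
    simp only [QuaternionAlgebra.re_add, QuaternionAlgebra.imI_add, QuaternionAlgebra.imJ_add,
      QuaternionAlgebra.imK_add]
    module
  map_smul' c q := by
    simp only [QuaternionAlgebra.re_smul, QuaternionAlgebra.imI_smul, QuaternionAlgebra.imJ_smul,
      QuaternionAlgebra.imK_smul, RingHom.id_apply, smul_eq_mul]
    module

theorem bil_mul_one {u v : C.carrier} (hu : C.bil u 1 = 0) (huv : C.bil u v = 0) :
    C.bil (u * v) 1 = 0 := by
  rw [C.bil_mul_conj_left, mul_one, conj_of_bil_one hu]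
  simp only [bil, polar_neg_right] at *
  rw [polar_comm, huv, neg_zero]

/-- The products among `1, u, v, uv` follow from the two alternative identities for pure elements
and anticommutativity, without associativity of the algebra. -/
theorem quatMap_mul {u v : C.carrier} (hu : C.bil u 1 = 0) (hv : C.bil v 1 = 0)
    (huv : C.bil u v = 0) {a b : k} (ha : C.norm u = -a)
    (hb : C.norm v = -b) (p q : QuaternionAlgebra k a 0 b) :
    quatMap C a b u v (p * q) = quatMap C a b u v p * quatMap C a b u v q := by
  have huu := mul_self_of_bil_one hu
  have hvv := mul_self_of_bil_one hv
  have hvu := mul_comm_of_bil hu hv huv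
  have huw := mul_mul_of_bil_one hu v
  have hwv := mul_mul_of_bil_one' hv u
  have hvw : v * (u * v) = b • -u := by
    have := mul_mul_of_bil_one hv u
    rw [hvu, mul_neg, hb, neg_neg] at this
    rw [smul_neg, ← this, neg_neg]
  have hwu : (u * v) * u = a • -v := by
    have := mul_mul_of_bil_one' hu v
    rw [hvu, neg_mul, ha, neg_neg] at this
    rw [smul_neg, ← this, neg_neg]
  have hww := mul_self_of_bil_one (bil_mul_one hu huv)
  rw [C.norm_mul, ha, hb] at hww
  rw [ha] at huu huw
  rw [hb] at hvv hwv
  simp only [quatMap, LinearMap.coe_mk, AddHom.coe_mk, QuaternionAlgebra.re_mul,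
    QuaternionAlgebra.imI_mul, QuaternionAlgebra.imJ_mul, QuaternionAlgebra.imK_mul,
    add_mul, mul_add, smul_mul_assoc, mul_smul_comm, one_mul, mul_one, huu, hvv, hvu, huw, hwv,
    hvw, hwu, hww]
  module

/-- The four images `1, u, v, uv` are pairwise orthogonal with nonzero norms, hence independent. -/
theorem quatMap_injective (h2 : (2 : k) ≠ 0) {u v : C.carrier} (hu : C.bil u 1 = 0)
    (hv : C.bil v 1 = 0) (huv : C.bil u v = 0) (hNu : C.norm u ≠ 0) (hNv : C.norm v ≠ 0)
    (a b : k) : Function.Injective (quatMap C a b u v) := by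
  have hw := bil_mul_one hu huv
  have huw : C.bil u (u * v) = 0 := by
    have := C.bil_mul_left u 1 v
    rw [mul_one] at this
    rw [this, bil, polar_comm, ← bil, hv, mul_zero]
  have hvw : C.bil v (u * v) = 0 := by
    have := C.bil_mul_right 1 u v
    rw [one_mul] at this
    rw [this, bil, polar_comm, ← bil, hu, zero_mul]
  refine (injective_iff_map_eq_zero _).mpr fun q hq => ?_
  simp only [quatMap, LinearMap.coe_mk, AddHom.coe_mk] at hq
  have key : ∀ z, C.bil (q.re • 1 + q.imI • u + q.imJ • v + q.imK • (u * v)) z = 0 := by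
    intro z; rw [hq]; simp [bil]
  have k0 := key 1
  have k1 := key u
  have k2 := key v
  have k3 := key (u * v)
  simp only [bil, polar_add_left, polar_smul_left, polar_self, C.norm_one, C.norm_mul,
    smul_eq_mul, nsmul_eq_mul] at k0 k1 k2 k3 hu hv huv hw huw hvw
  simp only [hu, hv, huv, hw, huw, hvw, polar_comm _ 1 u, polar_comm _ 1 v,
    polar_comm _ 1 (u * v), polar_comm _ v u, polar_comm _ (u * v) u,
    polar_comm _ (u * v) v] at k0 k1 k2 k3
  ext
  · simpa [h2] using k0
  · simpa [h2, hNu] using k1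
  · simpa [h2, hNv] using k2
  · simpa [h2, hNu, hNv] using k3

end CompositionAlgebra

/-! ### The standard composition algebras -/

theorem nondegenerate_polarBilin_of_equivalent (h2 : (2 : k) ≠ 0) {M : Type*} [AddCommGroup M]
    [Module k M] {n : ℕ} {w : Fin n → k} (hw : ∀ i, w i ≠ 0) (e : M ≃ₗ[k] (Fin n → k)) :
    (((weightedSumSquares k w).comp e.toLinearMap).polarBilin).Nondegenerate := by
  have hsymm : ∀ x y, ((weightedSumSquares k w).comp e.toLinearMap).polarBilin x y =
      ((weightedSumSquares k w).comp e.toLinearMap).polarBilin y x := by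
    intro x y
    simp only [polarBilin_apply_apply]
    exact polar_comm _ x y
  have hl : ∀ x, (∀ y, ((weightedSumSquares k w).comp e.toLinearMap).polarBilin x y = 0) →
      x = 0 := by
    intro x hx
    refine e.map_eq_zero_iff.mp (funext fun i => ?_)
    have h := hx (e.symm (Pi.single i 1))
    simp only [polarBilin_apply_apply, polar, QuadraticMap.comp_apply, LinearEquiv.coe_coe,
      map_add, LinearEquiv.apply_symm_apply, weightedSumSquares_apply, ← Finset.sum_sub_distrib,
      Pi.add_apply] at h
    rw [Finset.sum_eq_single i (by intro j _ hj; simp [Pi.single_eq_of_ne hj]) (by simp)] at h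
    have h' : (2 * w i) * e x i = 0 := by
      simp only [Pi.single_eq_same, smul_eq_mul] at h
      linear_combination h
    simpa [h2, hw i] using h'
  exact ⟨hl, fun y hy => hl y fun x => (hsymm y x).trans (hy x)⟩

/-- The one-dimensional composition algebra `k`. -/
def alg1 (h2 : (2 : k) ≠ 0) : CompositionAlgebra k where
  carrier := k
  norm := (weightedSumSquares k ![(1 : k)]).comp
    (LinearEquiv.funUnique (Fin 1) k k).symm.toLinearMap
  nondegenerate := nondegenerate_polarBilin_of_equivalent h2 (by simp) _
  norm_mul x y := by
    simp [weightedSumSquares_apply]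
    ring

/-- The two-dimensional composition algebra `k[√a]`. -/
def alg2 (h2 : (2 : k) ≠ 0) {a : k} (ha : a ≠ 0) : CompositionAlgebra k where
  carrier := QuadraticAlgebra k a 0
  norm := (weightedSumSquares k ![1, -a]).comp
    (QuadraticAlgebra.linearEquivTuple a 0).toLinearMap
  nondegenerate := nondegenerate_polarBilin_of_equivalent h2
    (by simp [Fin.forall_fin_succ, ha]) _
  norm_mul x y := by
    simp [weightedSumSquares_apply]
    ring

/-- The quaternion algebra with norm `⟨1, a, b, ab⟩`. -/
def alg4 (h2 : (2 : k) ≠ 0) {a b : k} (ha : a ≠ 0) (hb : b ≠ 0) : CompositionAlgebra k where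
  carrier := QuaternionAlgebra k (-a) 0 (-b)
  norm := (weightedSumSquares k ![1, a, b, a * b]).comp
    (QuaternionAlgebra.linearEquivTuple (-a) 0 (-b)).toLinearMap
  nondegenerate := nondegenerate_polarBilin_of_equivalent h2
    (by simp [Fin.forall_fin_succ, ha, hb]) _
  norm_mul x y := by
    simp [weightedSumSquares_apply, Fin.sum_univ_four]
    ring

/-! ### Classification of composition algebras of dimension at most four by their norms -/

namespace CompositionAlgebra

theorem Iso.symm {C D : CompositionAlgebra k} (h : C.Iso D) : D.Iso C := by
  obtain ⟨f, hf⟩ := h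
  exact ⟨f.symm, fun x y => f.injective (by simp [hf])⟩

theorem Iso.trans {C D E : CompositionAlgebra k} (h : C.Iso D) (h' : D.Iso E) : C.Iso E := by
  obtain ⟨f, hf⟩ := h
  obtain ⟨g, hg⟩ := h'
  exact ⟨f.trans g, fun x y => by simp [hf, hg]⟩

theorem iso_of_injective {C D : CompositionAlgebra k} [FiniteDimensional k C.carrier]
    (f : D.carrier →ₗ[k] C.carrier) (hmul : ∀ x y, f (x * y) = f x * f y)
    (hf : Function.Injective f)
    (hd : Module.finrank k C.carrier ≤ Module.finrank k D.carrier) : C.Iso D := by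
  have : FiniteDimensional k D.carrier := FiniteDimensional.of_injective f hf
  have hd' := le_antisymm hd (LinearMap.finrank_le_finrank_of_injective hf)
  refine Iso.symm ⟨LinearEquiv.ofInjectiveOfFinrankEq f hf hd'.symm, hmul⟩

/-- Isomorphisms of composition algebras preserve the unit and the norm. -/
theorem map_one_and_norm {C D : CompositionAlgebra k} (f : C.carrier ≃ₗ[k] D.carrier)
    (hf : ∀ x y, f (x * y) = f x * f y) : f 1 = 1 ∧ ∀ x, D.norm (f x) = C.norm x := by
  have h1 : f 1 = 1 := by
    have := hf 1 (f.symm 1)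
    rw [one_mul, f.apply_symm_apply, mul_one] at this
    exact this.symm
  refine ⟨h1, fun x => ?_⟩
  have e1 := congrArg f (C.mul_self_eq x)
  rw [hf, map_sub, map_smul, map_smul, h1, D.mul_self_eq (f x)] at e1
  by_cases ht : D.bil (f x) 1 = C.bil x 1
  · rw [ht, sub_right_inj] at e1
    have : (D.norm (f x) - C.norm x) • (1 : D.carrier) = 0 := by rw [sub_smul, e1, sub_self]
    exact sub_eq_zero.mp ((smul_eq_zero.mp this).resolve_right one_ne_zero)
  -- If the traces of `x` and `f x` differ, the two quadratic equations force `f x`, and hence `x`,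
  -- to be a scalar, where the norms agree directly.
  · have hne := sub_ne_zero.mpr ht
    have e2 : (D.bil (f x) 1 - C.bil x 1) • f x =
        (D.norm (f x) - C.norm x) • (1 : D.carrier) := by
      rw [sub_smul, sub_smul, sub_eq_sub_iff_sub_eq_sub, e1]
    obtain ⟨c, hc⟩ : ∃ c : k, f x = c • (1 : D.carrier) :=
      ⟨_, by rw [mul_smul (D.bil (f x) 1 - C.bil x 1)⁻¹ _ (1 : D.carrier), ← e2, smul_smul,
        inv_mul_cancel₀ hne, one_smul]⟩
    have hx : x = c • (1 : C.carrier) := f.injective (by rw [hc, map_smul, h1])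
    rw [hc, hx, QuadraticMap.map_smul, QuadraticMap.map_smul, C.norm_one, D.norm_one]

theorem Iso.equivalent {C D : CompositionAlgebra k} (h : C.Iso D) :
    QuadraticMap.Equivalent C.norm D.norm := by
  obtain ⟨f, hf⟩ := h
  exact ⟨⟨f, (map_one_and_norm f hf).2⟩⟩

variable {C : CompositionAlgebra k}

/-- Orthogonal projection splits off the span of the `v i`, and the form stays nondegenerate on the
complement. For a nonorthogonal pair there, one of the two vectors or their sum is anisotropic. No
finiteness of dimension is used. -/
theorem exists_orthogonal {ι : Type*} [Fintype ι] [DecidableEq ι] (h2 : (2 : k) ≠ 0)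
    {v : ι → C.carrier}
    (hv : ∀ i j, i ≠ j → C.bil (v i) (v j) = 0) (hN : ∀ i, C.norm (v i) ≠ 0)
    (hs : Submodule.span k (Set.range v) ≠ ⊤) :
    ∃ u, C.norm u ≠ 0 ∧ ∀ i, C.bil u (v i) = 0 := by
  have hproj : ∀ x : C.carrier, ∃ s ∈ Submodule.span k (Set.range v),
      ∀ i, C.bil (x - s) (v i) = 0 := by
    intro x
    refine ⟨∑ j, (C.bil x (v j) / (2 * C.norm (v j))) • v j,
      Submodule.sum_mem _ fun j _ => Submodule.smul_mem _ _ (Submodule.subset_span ⟨j, rfl⟩),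
      fun i => ?_⟩
    change C.norm.polarBilin _ (v i) = 0
    rw [map_sub, LinearMap.sub_apply, map_sum, LinearMap.sum_apply,
      Finset.sum_eq_single i]
    · have := hN i
      simp only [map_smul, LinearMap.smul_apply, polarBilin_apply_apply, polar_self, smul_eq_mul,
        nsmul_eq_mul, Nat.cast_ofNat, bil]
      field_simp
      ring
    · intro j _ hj
      have := hv j i hj
      simp only [map_smul, LinearMap.smul_apply, polarBilin_apply_apply, bil] at *
      rw [this, smul_zero]
    · simp
  obtain ⟨x, hx⟩ : ∃ x, x ∉ Submodule.span k (Set.range v) := by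
    by_contra! h
    exact hs (Submodule.eq_top_iff'.mpr h)
  obtain ⟨s, hs, hxs⟩ := hproj x
  have hne : x - s ≠ 0 := fun h => hx (by rw [sub_eq_zero.mp h]; exact hs)
  obtain ⟨y, hy⟩ : ∃ y, C.bil (x - s) y ≠ 0 := by
    by_contra! h
    exact hne (C.nondegenerate.1 _ h)
  obtain ⟨t, ht, hyt⟩ := hproj y
  have hst : C.bil (x - s) t = 0 := by
    have : t ∈ LinearMap.ker (C.norm.polarBilin (x - s)) := by
      refine Submodule.span_le.mpr ?_ ht
      rintro _ ⟨i, rfl⟩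
      exact hxs i
    exact this
  have hxy : C.bil (x - s) (y - t) ≠ 0 := by
    simp only [bil, polar_sub_right _ (x - s)] at *
    rwa [hst, sub_zero]
  by_cases n1 : C.norm (x - s) = 0
  · by_cases n2 : C.norm (y - t) = 0
    · refine ⟨(x - s) + (y - t), ?_, fun i => ?_⟩
      · rw [C.norm_add, n1, n2, zero_add, zero_add]
        exact hxy
      · simp only [bil, polar_add_left _ (x - s)] at *
        rw [hxs, hyt, add_zero]
    · exact ⟨_, n2, hyt⟩
  · exact ⟨_, n1, hxs⟩

theorem finrank_alg1 (h2 : (2 : k) ≠ 0) : Module.finrank k (alg1 h2).carrier = 1 :=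
  Module.finrank_self k

theorem finrank_alg2 (h2 : (2 : k) ≠ 0) {a : k} (ha : a ≠ 0) :
    Module.finrank k (alg2 h2 ha).carrier = 2 :=
  QuadraticAlgebra.finrank_eq_two a 0

theorem finrank_alg4 (h2 : (2 : k) ≠ 0) {a b : k} (ha : a ≠ 0) (hb : b ≠ 0) :
    Module.finrank k (alg4 h2 ha hb).carrier = 4 :=
  QuaternionAlgebra.finrank_eq_four (-a) 0 (-b)

theorem iso_alg1 [FiniteDimensional k C.carrier] (h2 : (2 : k) ≠ 0)
    (hd : Module.finrank k C.carrier ≤ 1) : C.Iso (alg1 h2) := by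
  refine iso_of_injective (D := alg1 h2) (LinearMap.toSpanSingleton k C.carrier 1) ?_ ?_
    (hd.trans (finrank_alg1 h2).ge)
  · have : ∀ x y : k, (x * y) • (1 : C.carrier) = x • (1 : C.carrier) * y • (1 : C.carrier) := by
      intro x y
      rw [smul_mul_smul_comm, one_mul]
    exact this
  · intro x y h
    exact smul_left_injective k (one_ne_zero (α := C.carrier)) h

theorem iso_alg2 [FiniteDimensional k C.carrier] (h2 : (2 : k) ≠ 0) {a : k} (ha : a ≠ 0)
    (hd : Module.finrank k C.carrier ≤ 2) {u : C.carrier} (hu : C.bil u 1 = 0)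
    (hN : C.norm u = -a) : C.Iso (alg2 h2 ha) :=
  iso_of_injective (D := alg2 h2 ha) (quadMap C a u) (quadMap_mul hu hN)
    (quadMap_injective h2 hu (by rw [hN]; exact neg_ne_zero.mpr ha) a)
    (hd.trans (finrank_alg2 h2 ha).ge)

theorem iso_alg4 [FiniteDimensional k C.carrier] (h2 : (2 : k) ≠ 0) {a b : k} (ha : a ≠ 0)
    (hb : b ≠ 0) (hd : Module.finrank k C.carrier ≤ 4) {u v : C.carrier} (hu : C.bil u 1 = 0)
    (hv : C.bil v 1 = 0) (huv : C.bil u v = 0) (hNu : C.norm u = a) (hNv : C.norm v = b) :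
    C.Iso (alg4 h2 ha hb) :=
  iso_of_injective (D := alg4 h2 ha hb) (quatMap C (-a) (-b) u v)
    (quatMap_mul hu hv huv (by rw [hNu, neg_neg]) (by rw [hNv, neg_neg]))
    (quatMap_injective h2 hu hv huv (by rwa [hNu]) (by rwa [hNv]) (-a) (-b))
    (hd.trans (finrank_alg4 h2 ha hb).ge)

theorem finiteDimensional_of_rank_le (hC : Module.rank k C.carrier ≤ 4) :
    FiniteDimensional k C.carrier :=
  Module.rank_lt_aleph0_iff.mp (hC.trans_lt (Cardinal.natCast_lt_aleph0 (n := 4)))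

theorem finrank_le_four (hC : Module.rank k C.carrier ≤ 4) : Module.finrank k C.carrier ≤ 4 :=
  Module.finrank_le_of_rank_le (n := 4) hC

/-- The classification of composition algebras of dimension at most four. -/
theorem iso_standard (h2 : (2 : k) ≠ 0) (hC : Module.rank k C.carrier ≤ 4) :
    C.Iso (alg1 h2) ∨ (∃ (a : k) (ha : a ≠ 0), C.Iso (alg2 h2 ha)) ∨
      ∃ (a b : k) (ha : a ≠ 0) (hb : b ≠ 0), C.Iso (alg4 h2 ha hb) := by
  have := finiteDimensional_of_rank_le hC
  have hC4 := finrank_le_four hC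
  have hrank : ∀ {n : ℕ} (v : Fin n → C.carrier), Submodule.span k (Set.range v) = ⊤ →
      Module.finrank k C.carrier ≤ n := by
    intro n v hv
    have := finrank_range_le_card (R := k) v
    rwa [Set.finrank, hv, finrank_top, Fintype.card_fin] at this
  by_cases h1 : Submodule.span k (Set.range ![(1 : C.carrier)]) = ⊤
  · exact Or.inl (iso_alg1 h2 (hrank _ h1))
  right
  obtain ⟨u, hNu, hu⟩ := exists_orthogonal (C := C) h2
    (by intro i j h; exact absurd (Subsingleton.elim i j) h)
    (by intro i; fin_cases i; simp [C.norm_one]) h1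
  have hu1 : C.bil u 1 = 0 := hu 0
  have h1u : C.bil 1 u = 0 := by rwa [bil, polar_comm]
  by_cases h3 : Submodule.span k (Set.range ![(1 : C.carrier), u]) = ⊤
  · exact Or.inl ⟨-C.norm u, neg_ne_zero.mpr hNu,
      iso_alg2 h2 _ (hrank _ h3) hu1 (neg_neg _).symm⟩
  right
  obtain ⟨v, hNv, hv⟩ := exists_orthogonal (C := C) h2
    (by intro i j h; fin_cases i <;> fin_cases j <;> simp_all)
    (by intro i; fin_cases i <;> simp [C.norm_one, hNu]) h3
  have hv1 : C.bil v 1 = 0 := hv 0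
  have huv : C.bil u v = 0 := by rw [bil, polar_comm]; exact hv 1
  -- Two orthogonal pure generators already embed a four-dimensional algebra, so dimension 3 cannot
  -- occur.
  exact ⟨C.norm u, C.norm v, hNu, hNv, iso_alg4 h2 hNu hNv hC4 hu1 hv1 huv rfl rfl⟩

theorem finrank_eq_of_iso {C D : CompositionAlgebra k} (h : C.Iso D) :
    Module.finrank k C.carrier = Module.finrank k D.carrier := by
  obtain ⟨f, -⟩ := h
  exact f.finrank_eq

theorem finrank_eq_of_equivalent {n : ℕ} {w : Fin n → k}
    (h : QuadraticMap.Equivalent C.norm (weightedSumSquares k w)) :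
    Module.finrank k C.carrier = n := by
  obtain ⟨f⟩ := h
  rw [f.toLinearEquiv.finrank_eq, Module.finrank_fin_fun]

/-- If the norm is a diagonal form `⟨1, w₁, …⟩`, then there are orthogonal pure elements of norm
`w₁, …`. -/
theorem exists_pure {n : ℕ} {w : Fin (n + 1) → k} (hw : w 0 = 1)
    (h : QuadraticMap.Equivalent C.norm (weightedSumSquares k w)) :
    ∃ u : Fin n → C.carrier, (∀ i, C.bil (u i) 1 = 0) ∧ (∀ i, C.norm (u i) = w i.succ) ∧
      ∀ i j, i ≠ j → C.bil (u i) (u j) = 0 := by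
  obtain ⟨f⟩ := h
  let b : Fin (n + 1) → C.carrier := fun i => f.symm (Pi.single i 1)
  have hf : ∀ x, C.norm (f.symm x) = ∑ i, w i * (x i * x i) := by
    intro x
    rw [f.symm.map_app, weightedSumSquares_apply]
    rfl
  have hbN : ∀ i, C.norm (b i) = w i := by
    intro i
    rw [hf, Finset.sum_eq_single i (by intro j _ hj; simp [Pi.single_eq_of_ne hj]) (by simp)]
    simp
  have hbb : ∀ i j, i ≠ j → C.bil (b i) (b j) = 0 := by
    intro i j hij
    have h := C.norm_add (b i) (b j)
    rw [hbN, hbN] at h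
    have h' : C.norm (b i + b j) = w i + w j := by
      simp only [b]
      rw [← map_add, hf, Finset.sum_eq_add i j hij (by
        rintro l - ⟨h1, h2⟩
        simp [Pi.single_eq_of_ne h1, Pi.single_eq_of_ne h2]) (by simp) (by simp)]
      simp [hij, hij.symm]
    rw [h'] at h
    linear_combination -h
  -- The isometry need not match 1 with the first basis vector. Left multiplication by the conjugate
  -- of `b 0`, an element of norm 1, is an isometry taking `b 0` to 1, so no cancellation theorem
  -- for quadratic forms is needed.
  have hone : C.conj (b 0) * b 0 = 1 := by
    rw [C.conj_mul_self, hbN, hw, one_smul]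
  refine ⟨fun i => C.conj (b 0) * b i.succ, fun i => ?_, fun i => ?_, fun i j hij => ?_⟩
  · rw [← hone, C.bil_mul_left, hbb _ _ (Fin.succ_ne_zero i), mul_zero]
  · rw [C.norm_mul, C.norm_conj, hbN, hbN, hw, one_mul]
  · rw [C.bil_mul_left, hbb _ _ (fun h => hij (Fin.succ_injective _ h)), mul_zero]

theorem equivalent_alg1_iff (h2 : (2 : k) ≠ 0) (hC : Module.rank k C.carrier ≤ 4) :
    QuadraticMap.Equivalent C.norm (weightedSumSquares k ![(1 : k)]) ↔ C.Iso (alg1 h2) := by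
  have := finiteDimensional_of_rank_le hC
  refine ⟨fun h => iso_alg1 h2 (finrank_eq_of_equivalent h).le, fun h => h.equivalent.trans ?_⟩
  exact ⟨⟨(LinearEquiv.funUnique (Fin 1) k k).symm, fun x => rfl⟩⟩

theorem equivalent_alg2_iff (h2 : (2 : k) ≠ 0) (hC : Module.rank k C.carrier ≤ 4) {a : k}
    (ha : a ≠ 0) :
    QuadraticMap.Equivalent C.norm (weightedSumSquares k ![1, -a]) ↔ C.Iso (alg2 h2 ha) := by
  have := finiteDimensional_of_rank_le hC
  refine ⟨fun h => ?_, fun h => h.equivalent.trans ?_⟩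
  · obtain ⟨u, hu, hN, -⟩ := exists_pure (by simp) h
    exact iso_alg2 h2 ha (finrank_eq_of_equivalent h).le (hu 0) (hN 0)
  · exact ⟨⟨QuadraticAlgebra.linearEquivTuple a 0, fun x => rfl⟩⟩

theorem equivalent_alg4_iff (h2 : (2 : k) ≠ 0) (hC : Module.rank k C.carrier ≤ 4) {a b c : k}
    (ha : a ≠ 0) (hb : b ≠ 0) (hc : c ≠ 0) :
    QuadraticMap.Equivalent C.norm (weightedSumSquares k ![1, b * c, a * c, a * b]) ↔
      C.Iso (alg4 h2 (mul_ne_zero hb hc) (mul_ne_zero ha hc)) := by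
  have := finiteDimensional_of_rank_le hC
  refine ⟨fun h => ?_, fun h => h.equivalent.trans (QuadraticMap.Equivalent.trans
    (Q₂ := weightedSumSquares k ![1, b * c, a * c, b * c * (a * c)]) ?_ ?_)⟩
  · obtain ⟨u, hu, hN, huu⟩ := exists_pure (by simp) h
    exact iso_alg4 h2 _ _ (finrank_eq_of_equivalent h).le (hu 0) (hu 1) (huu 0 1 (by simp))
      (hN 0) (hN 1)
  · exact ⟨⟨QuaternionAlgebra.linearEquivTuple _ 0 _, fun x => rfl⟩⟩
  -- Since `bc · ac = c² · ab`, scaling the last coordinate by `c` relates the two diagonal forms.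
  · refine ⟨⟨LinearEquiv.piCongrRight fun i =>
      LinearEquiv.smulOfNeZero k k (![1, 1, 1, c] i) (by fin_cases i <;> simp [hc]), fun x => ?_⟩⟩
    simp [weightedSumSquares_apply, Fin.sum_univ_four]
    ring

end CompositionAlgebra

/-! ### The covariant of the normal forms -/

theorem covariant_apply (x : Wedge3 k) (i j : Fin 3 ⊕ Fin 3) :
    covariant x i j = ∑ a, ∑ b,
      (tens x i (.inl a) (.inr b) * tens x j (.inl b) (.inr a)
        - tens x i (.inl a) (.inl b) * tens x j (.inr b) (.inr a)
        - tens x i (.inr a) (.inr b) * tens x j (.inl b) (.inl a)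
        + tens x i (.inr a) (.inl b) * tens x j (.inr b) (.inl a)) := by
  have h : ∀ l p a, (slice x l * J (Fin 3) k) p (.inl a) = tens x l p (.inr a) ∧
      (slice x l * J (Fin 3) k) p (.inr a) = -tens x l p (.inl a) := by
    intro l p a
    simp [slice, J, mul_apply, Fintype.sum_sum_type, one_apply]
  simp only [covariant, of_apply]
  rw [Matrix.mul_assoc (slice x i * _), trace]
  simp only [diag_apply, mul_apply (M := slice x i * _), Fintype.sum_sum_type, h,
    ← Finset.sum_add_distrib]
  refine Finset.sum_congr rfl fun a _ => Finset.sum_congr rfl fun b _ => ?_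
  ring

theorem covariant_rep1 : covariant (rep1 k) = fromBlocks (diagonal ![0, 0, 0]) 0 0 0 := by
  obtain ⟨r1, r2, r3, r4⟩ := rep1_blocks (k := k)
  ext (i | i) (j | j) <;> fin_cases i <;> fin_cases j <;>
    simp [covariant_apply, Fin.sum_univ_three, r1, r2, r3, r4]

theorem covariant_rep2 (a : k) :
    covariant (rep2 a) = fromBlocks (diagonal ![-4 * a, 0, 0]) 0 0 0 := by
  obtain ⟨r1, r2, r3, r4⟩ := rep2_blocks a
  ext (i | i) (j | j) <;> fin_cases i <;> fin_cases j <;>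
    simp [covariant_apply, Fin.sum_univ_three, r1, r2, r3, r4]
  ring

theorem covariant_rep4 (a b c : k) :
    covariant (rep4 a b c) =
      fromBlocks (diagonal ![-4 * (b * c), -4 * (a * c), -4 * (a * b)]) 0 0 0 := by
  obtain ⟨r1, r2, r3, r4⟩ := rep4_blocks a b c
  ext (i | i) (j | j) <;> fin_cases i <;> fin_cases j <;>
    simp [covariant_apply, Fin.sum_univ_three, r1, r2, r3, r4] <;> ring

/-- When the covariant lives only in the upper left block, only that block of `g` matters. It may be
singular, so symmetry of the orbit relation is used later to compare ranks. -/
theorem congruent_of_mem_orbit {x y : Wedge3 k} {D E : Matrix (Fin 3) (Fin 3) k}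
    (hx : covariant x = fromBlocks D 0 0 0) (hy : covariant y = fromBlocks E 0 0 0)
    (h : y ∈ spOrbit x) : ∃ G : Matrix (Fin 3) (Fin 3) k, E = G * D * Gᵀ := by
  obtain ⟨g, rfl⟩ := h
  rw [covariant_act, hx, ← fromBlocks_toBlocks g.1, fromBlocks_transpose, fromBlocks_multiply,
    fromBlocks_multiply] at hy
  exact ⟨g.1.toBlocks₁₁, by simpa using (congrArg toBlocks₁₁ hy).symm⟩

/-! ### Scalars -/

theorem blocks_smul (c : k) (x : Wedge3 k) : x0 (c • x) = c * x0 x ∧ y0 (c • x) = c * y0 x ∧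
    matA (c • x) = c • matA x ∧ matB (c • x) = c • matB x := by
  refine ⟨by simp [x0], by simp [y0], ?_, ?_⟩ <;> ext i j <;> simp [matA, matB]

theorem smul_rep_of_matA {x : Wedge3 k} {a c : k} (hc : c ≠ 0) (hA : matA x = 0)
    (hB : matB x = diagonal ![a, 0, 0]) (hy : y0 x = 0) : c • x ∈ spOrbit x := by
  -- Determinant `c` scales `x₀` by `c`, and the single entry of `B` is multiplied by `c⁻¹ c² = c`.
  let h : Matrix (Fin 3) (Fin 3) k := diagonal ![c, 1, 1]
  have hd : h.det = c := by simp [h, Fin.prod_univ_three]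
  obtain ⟨y, hyx, y1, y2, y3, y4⟩ := exists_levi (h := h) (by rwa [hd]) hA
  obtain ⟨s1, s2, s3, s4⟩ := blocks_smul c x
  have : c • x = y := by
    refine ext_blocks ?_ ?_ ?_ ?_
    · rw [s1, y1, hd]
    · rw [s3, y3, hA, smul_zero]
    · rw [s4, y4, hd, hB, diagonal_transpose, diagonal_mul_diagonal, diagonal_mul_diagonal,
        ← diagonal_smul, ← diagonal_smul]
      congr 1
      funext i
      fin_cases i <;> simp [hc]
      field_simp
    · rw [s2, y2, hy, mul_zero, mul_zero]
  rw [this]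
  exact hyx

theorem smul_rep4_mem (a b d : k) {c : k} (hc : c ≠ 0) : c • rep4 a b d ∈ spOrbit (rep4 a b d) := by
  obtain ⟨r1, r2, r3, r4⟩ := rep4_blocks a b d
  have hd : ((c⁻¹ : k) • (1 : Matrix (Fin 3) (Fin 3) k)).det = (c ^ 3)⁻¹ := by
    simp [det_smul]
  -- After `J` moves `A` into `B`, the scalar matrix `c⁻¹` multiplies `B` by `c³ c⁻² = c`.
  obtain ⟨y, hyx, y1, y2, y3, y4⟩ := exists_levi (h := (c⁻¹ : k) • 1)
    (by rw [hd]; exact inv_ne_zero (pow_ne_zero 3 hc))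
    (x := act (J (Fin 3) k) (rep4 a b d)) (by rw [matA_act_J, r3])
  obtain ⟨s1, s2, s3, s4⟩ := blocks_smul c (rep4 a b d)
  have : act (J (Fin 3) k) (c • rep4 a b d) = y := by
    refine ext_blocks ?_ ?_ ?_ ?_
    · rw [x0_act_J, s2, y1, x0_act_J, r4]; simp
    · rw [matA_act_J, s4, r3, y3, smul_zero]
    · rw [matB_act_J, s3, y4, matB_act_J, r2, hd, transpose_smul, transpose_one]
      simp only [Matrix.mul_neg, Matrix.neg_mul, Matrix.smul_mul, Matrix.mul_smul, smul_neg,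
        smul_smul, Matrix.one_mul, Matrix.mul_one]
      congr 2
      field_simp
    · rw [y0_act_J, s1, y2, y0_act_J, r1]; simp
  refine spOrbit_trans (spOrbit_trans (act_J_mem _) hyx) (spOrbit_symm ?_)
  rw [← this]
  exact act_J_mem _

theorem smul_mem_spOrbit (h2 : (2 : k) ≠ 0) {x : Wedge3 k} (hx : x ∈ nonzeroNullCone k) {c : k}
    (hc : c ≠ 0) : c • x ∈ spOrbit x := by
  have key : ∀ r ∈ spOrbit x, c • r ∈ spOrbit r → c • x ∈ spOrbit x := by
    intro r hr hcr
    obtain ⟨g, hg⟩ := spOrbit_symm hr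
    refine spOrbit_trans hr (spOrbit_trans hcr ⟨g, ?_⟩)
    rw [map_smul, ← hg]
  rcases exists_rep_mem_spOrbit h2 hx with h | ⟨a, ha, h⟩ | ⟨a, b, d, ha, hb, hd, h⟩
  · obtain ⟨r1, r2, r3, r4⟩ := rep1_blocks (k := k)
    refine key _ h (smul_rep_of_matA (a := 0) hc r2 ?_ r4)
    rw [r3]
    ext i j
    fin_cases i <;> fin_cases j <;> simp
  · obtain ⟨r1, r2, r3, r4⟩ := rep2_blocks a
    exact key _ h (smul_rep_of_matA hc r2 r3 r4)
  · exact key _ h (smul_rep4_mem a b d hc)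

theorem spGLOrbit_eq (h2 : (2 : k) ≠ 0) {x : Wedge3 k} (hx : x ∈ nonzeroNullCone k) :
    spGLOrbit x = spOrbit x := by
  ext y
  constructor
  · rintro ⟨⟨g, c⟩, rfl⟩
    rw [← map_smul]
    exact spOrbit_trans (smul_mem_spOrbit h2 hx c.ne_zero) ⟨g, rfl⟩
  · rintro ⟨g, rfl⟩
    exact ⟨⟨g, 1⟩, by simp⟩

theorem spOrbit_eq_iff {x y : Wedge3 k} : spOrbit x = spOrbit y ↔ y ∈ spOrbit x := by
  constructor
  · intro h; rw [h]; exact mem_spOrbit_self y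
  · intro h
    ext z
    exact ⟨fun hz => spOrbit_trans (spOrbit_symm h) hz, fun hz => spOrbit_trans h hz⟩

/-! ### Orbits and isomorphism classes -/

theorem rank_alg1_le (h2 : (2 : k) ≠ 0) : Module.rank k (alg1 h2).carrier ≤ 4 := by
  change Module.rank k k ≤ 4
  rw [Module.rank_self]
  norm_num

theorem rank_alg2_le (h2 : (2 : k) ≠ 0) {a : k} (ha : a ≠ 0) :
    Module.rank k (alg2 h2 ha).carrier ≤ 4 := by
  change Module.rank k (QuadraticAlgebra k a 0) ≤ 4
  rw [QuadraticAlgebra.rank_eq_two]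
  norm_num

theorem rank_alg4_le (h2 : (2 : k) ≠ 0) {a b : k} (ha : a ≠ 0) (hb : b ≠ 0) :
    Module.rank k (alg4 h2 ha hb).carrier ≤ 4 := by
  change Module.rank k (QuaternionAlgebra k (-a) 0 (-b)) ≤ 4
  rw [QuaternionAlgebra.rank_eq_four]

theorem rep2_mem_of_eq {a b s : k} (hb : b ≠ 0) (h : b = s ^ 2 * a) :
    rep2 b ∈ spOrbit (rep2 a) := by
  have hs : s ≠ 0 := by rintro rfl; simp at h; exact hb h
  obtain ⟨r1, r2, r3, r4⟩ := rep2_blocks a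
  obtain ⟨q1, q2, q3, q4⟩ := rep2_blocks b
  have hd : (diagonal ![s, s⁻¹, 1] : Matrix (Fin 3) (Fin 3) k).det = 1 := by
    simp [Fin.prod_univ_three, hs]
  obtain ⟨y, hyx, y1, y2, y3, y4⟩ := exists_levi (h := diagonal ![s, s⁻¹, 1]) (by simp [hd]) r2
  have : rep2 b = y := by
    refine ext_blocks ?_ ?_ ?_ ?_
    · rw [q1, y1, hd, r1, mul_one]
    · rw [q2, y3]
    · rw [q3, y4, hd, r3, diagonal_transpose, diagonal_mul_diagonal, diagonal_mul_diagonal,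
        inv_one, one_smul]
      congr 1
      funext i
      fin_cases i <;> simp [h]
      ring
    · rw [q4, y2, r4, mul_zero]
  rw [this]
  exact hyx

theorem adjugate_diagonal_fin_three (a b c : k) :
    (diagonal ![a, b, c]).adjugate = diagonal ![b * c, a * c, a * b] := by
  rw [adjugate_fin_three]
  ext i j
  fin_cases i <;> fin_cases j <;> simp

/-- The diagonal forms are the adjugates of `diag(a,b,c)` and `diag(a',b',c')`. Taking adjugates
again makes these matrices congruent up to a scalar, which the determinant twist of a Levi element
absorbs. -/
theorem rep4_mem_of_congruent {a b c a' b' c' : k} (ha : a ≠ 0) (hb : b ≠ 0) (hc : c ≠ 0)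
    (ha' : a' ≠ 0) (hb' : b' ≠ 0) (hc' : c' ≠ 0) {G : Matrix (Fin 3) (Fin 3) k}
    (h : diagonal ![b' * c', a' * c', a' * b'] = G * diagonal ![b * c, a * c, a * b] * Gᵀ) :
    rep4 a' b' c' ∈ spOrbit (rep4 a b c) := by
  obtain ⟨r1, r2, r3, r4⟩ := rep4_blocks a b c
  obtain ⟨q1, q2, q3, q4⟩ := rep4_blocks a' b' c'
  set A : Matrix (Fin 3) (Fin 3) k := diagonal ![a, b, c]
  set A' : Matrix (Fin 3) (Fin 3) k := diagonal ![a', b', c']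
  have hA : A.det ≠ 0 := by simp [A, Fin.prod_univ_three, ha, hb, hc]
  have hA' : A'.det ≠ 0 := by simp [A', Fin.prod_univ_three, ha', hb', hc']
  rw [← adjugate_diagonal_fin_three, ← adjugate_diagonal_fin_three] at h
  have hG : G.det ≠ 0 := by
    intro h0
    have := congrArg Matrix.det h
    rw [det_mul, det_mul, h0, zero_mul, zero_mul, det_adjugate] at this
    exact pow_ne_zero _ hA' this
  have hadj : A'.det • A' = A.det • (G.adjugateᵀ * A * G.adjugate) := by
    have := congrArg Matrix.adjugate h
    rw [adjugate_mul_distrib, adjugate_mul_distrib, adjugate_adjugate _ (by simp),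
      adjugate_adjugate _ (by simp), ← adjugate_transpose,
      show Fintype.card (Fin 3) - 2 = 1 from rfl, pow_one, pow_one] at this
    simpa only [Matrix.mul_smul, Matrix.smul_mul,
      Matrix.mul_assoc] using this
  -- For `h = l (G^#)ᵀ` the factor `det(h)⁻¹ l²` equals `1 / (l det(G)²)`, so this `l` makes it `det
  -- A / det A'`.
  set l : k := A'.det / (G.det ^ 2 * A.det) with hl
  have hl0 : l ≠ 0 := div_ne_zero hA' (mul_ne_zero (pow_ne_zero 2 hG) hA)
  have hd : (l • G.adjugateᵀ).det = l ^ 3 * G.det ^ 2 := by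
    rw [det_smul, det_transpose, det_adjugate]; simp
  obtain ⟨y, hyx, y1, y2, y3, y4⟩ := exists_levi (h := l • G.adjugateᵀ)
    (by rw [hd]; exact mul_ne_zero (pow_ne_zero 3 hl0) (pow_ne_zero 2 hG))
    (x := act (J (Fin 3) k) (rep4 a b c)) (by rw [matA_act_J, r3])
  have : act (J (Fin 3) k) (rep4 a' b' c') = y := by
    refine ext_blocks ?_ ?_ ?_ ?_
    · rw [x0_act_J, y1, x0_act_J, r4, q4]; simp
    · rw [matA_act_J, q3, y3]
    · have hB : matB y = -((A.det / A'.det) • (G.adjugateᵀ * A * G.adjugate)) := by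
        rw [y4, matB_act_J, r2, hd, transpose_smul, transpose_transpose]
        simp only [Matrix.mul_neg, Matrix.neg_mul, Matrix.smul_mul, Matrix.mul_smul, smul_neg,
          smul_smul]
        congr 2
        rw [hl]
        field_simp
      rw [hB, matB_act_J, q2, div_eq_inv_mul, mul_smul, ← hadj, smul_smul, inv_mul_cancel₀ hA',
        one_smul]
    · rw [y0_act_J, y2, y0_act_J, r1, q1]; simp
  refine spOrbit_trans (spOrbit_trans (act_J_mem _) hyx) (spOrbit_symm ?_)
  rw [← this]
  exact act_J_mem _

theorem eq_of_alg2_iso (h2 : (2 : k) ≠ 0) {a b : k} (ha : a ≠ 0) (hb : b ≠ 0)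
    (h : (alg2 h2 ha).Iso (alg2 h2 hb)) : ∃ s : k, b = s ^ 2 * a := by
  obtain ⟨u, hu, hN, -⟩ := CompositionAlgebra.exists_pure (by simp)
    ((CompositionAlgebra.equivalent_alg2_iff h2 (rank_alg2_le h2 ha) hb).mpr h)
  have hbil : ∀ q : QuadraticAlgebra k a 0, (alg2 h2 ha).bil q 1 = 2 * q.re := by
    intro q
    change polar ((weightedSumSquares k ![1, -a]).comp
      (QuadraticAlgebra.linearEquivTuple a 0).toLinearMap) q 1 = _
    simp [polar, weightedSumSquares_apply, QuadraticAlgebra.re_one, QuadraticAlgebra.im_one]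
    ring
  have hnorm : ∀ q : QuadraticAlgebra k a 0, (alg2 h2 ha).norm q = q.re ^ 2 - a * q.im ^ 2 := by
    intro q
    change (weightedSumSquares k ![1, -a]).comp
      (QuadraticAlgebra.linearEquivTuple a 0).toLinearMap q = _
    simp [weightedSumSquares_apply]
    ring
  have h1 := hu 0
  have h3 := hN 0
  generalize u 0 = q at h1 h3
  change QuadraticAlgebra k a 0 at q
  have h1' : q.re = 0 := by
    rw [hbil] at h1
    exact (mul_eq_zero.mp h1).resolve_left h2
  rw [hnorm, h1'] at h3
  refine ⟨q.im, ?_⟩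
  simp at h3
  linear_combination -h3

theorem congruent_of_alg4_iso (h2 : (2 : k) ≠ 0) {a b c a' b' c' : k} (ha : a ≠ 0) (hb : b ≠ 0)
    (hc : c ≠ 0) (ha' : a' ≠ 0) (hb' : b' ≠ 0) (hc' : c' ≠ 0)
    (h : (alg4 h2 (mul_ne_zero hb hc) (mul_ne_zero ha hc)).Iso
      (alg4 h2 (mul_ne_zero hb' hc') (mul_ne_zero ha' hc'))) :
    ∃ G : Matrix (Fin 3) (Fin 3) k,
      diagonal ![b' * c', a' * c', a' * b'] = G * diagonal ![b * c, a * c, a * b] * Gᵀ := by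
  set C := alg4 h2 (mul_ne_zero hb hc) (mul_ne_zero ha hc) with hC
  obtain ⟨u, hu, hN, huu⟩ := CompositionAlgebra.exists_pure (by simp)
    ((CompositionAlgebra.equivalent_alg4_iff h2 (rank_alg4_le h2 _ _) ha' hb' hc').mpr h)
  have hbil : ∀ p q : QuaternionAlgebra k (-(b * c)) 0 (-(a * c)), C.bil p q =
      2 * (p.re * q.re + b * c * (p.imI * q.imI) + a * c * (p.imJ * q.imJ)
        + b * c * (a * c) * (p.imK * q.imK)) := by
    intro p q
    change polar ((weightedSumSquares k ![1, b * c, a * c, b * c * (a * c)]).comp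
      (QuaternionAlgebra.linearEquivTuple _ _ _).toLinearMap) p q = _
    simp [polar, weightedSumSquares_apply, Fin.sum_univ_four]
    ring
  have hre : ∀ q : QuaternionAlgebra k (-(b * c)) 0 (-(a * c)), C.bil q 1 = 0 → q.re = 0 := by
    intro q hq
    have h1 : C.bil q 1 = 2 * q.re := (hbil q 1).trans (by simp)
    rw [h1] at hq
    exact (mul_eq_zero.mp hq).resolve_left h2
  let q : Fin 3 → QuaternionAlgebra k (-(b * c)) 0 (-(a * c)) := u
  -- The third basic pure quaternion has norm `bc · ac = c² · ab`, hence the factor `c` when its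
  -- coordinate is measured against `ab`.
  refine ⟨Matrix.of fun i => ![(q i).imI, (q i).imJ, c * (q i).imK], ?_⟩
  ext i j
  have hij : ((Matrix.of fun i => ![(q i).imI, (q i).imJ, c * (q i).imK]) *
      diagonal ![b * c, a * c, a * b] *
      (Matrix.of fun i => ![(q i).imI, (q i).imJ, c * (q i).imK])ᵀ) i j =
      b * c * ((q i).imI * (q j).imI) + a * c * ((q i).imJ * (q j).imJ)
        + b * c * (a * c) * ((q i).imK * (q j).imK) := by
    rw [mul_apply, Fin.sum_univ_three]
    simp [mul_diagonal]
    ring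
  have hb2 := hbil (q i) (q j)
  rw [hre _ (hu i), hre _ (hu j), mul_zero, zero_add, ← hij] at hb2
  refine mul_left_cancel₀ h2 (Eq.trans ?_ hb2)
  rw [diagonal_apply]
  split_ifs with hij'
  · subst hij'
    have h1 : C.bil (u i) (u i) = 2 * C.norm (u i) := by
      rw [CompositionAlgebra.bil, polar_self, nsmul_eq_mul, Nat.cast_ofNat]
    refine Eq.trans ?_ h1.symm
    rw [hN]
    fin_cases i <;> rfl
  · rw [mul_zero]
    exact (huu i j hij').symm

theorem alg2_iso_of_eq (h2 : (2 : k) ≠ 0) {a b s : k} (ha : a ≠ 0) (hb : b ≠ 0)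
    (h : b = s ^ 2 * a) : (alg2 h2 ha).Iso (alg2 h2 hb) := by
  have hs : s ≠ 0 := by rintro rfl; simp at h; exact hb h
  have hr := rank_alg2_le h2 ha
  refine (CompositionAlgebra.equivalent_alg2_iff h2 hr hb).mp
    (((CompositionAlgebra.equivalent_alg2_iff h2 hr ha).mpr
      ⟨LinearEquiv.refl k _, fun _ _ => rfl⟩).trans
      ⟨⟨LinearEquiv.piCongrRight fun i =>
        LinearEquiv.smulOfNeZero k k (![1, s⁻¹] i) (by fin_cases i <;> simp [hs]), fun x => ?_⟩⟩)
  simp [weightedSumSquares_apply, h]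
  field_simp

theorem alg4_iso_of_congruent (h2 : (2 : k) ≠ 0) {a b c a' b' c' : k} (ha : a ≠ 0) (hb : b ≠ 0)
    (hc : c ≠ 0) (ha' : a' ≠ 0) (hb' : b' ≠ 0) (hc' : c' ≠ 0) {G : Matrix (Fin 3) (Fin 3) k}
    (h : diagonal ![b' * c', a' * c', a' * b'] = G * diagonal ![b * c, a * c, a * b] * Gᵀ) :
    (alg4 h2 (mul_ne_zero hb hc) (mul_ne_zero ha hc)).Iso
      (alg4 h2 (mul_ne_zero hb' hc') (mul_ne_zero ha' hc')) := by
  have hr := rank_alg4_le h2 (mul_ne_zero hb hc) (mul_ne_zero ha hc)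
  set C := alg4 h2 (mul_ne_zero hb hc) (mul_ne_zero ha hc) with hC
  have := CompositionAlgebra.finiteDimensional_of_rank_le hr
  obtain ⟨u, hu, hN, huu⟩ := CompositionAlgebra.exists_pure (by simp)
    ((CompositionAlgebra.equivalent_alg4_iff h2 hr ha hb hc).mpr
      ⟨LinearEquiv.refl k _, fun _ _ => rfl⟩)
  -- The rows of `G` combine an orthogonal pure triple into another whose Gram matrix is twice the
  -- target form; its first two members generate the target algebra.
  let w : Fin 3 → C.carrier := fun i => G i 0 • u 0 + G i 1 • u 1 + G i 2 • u 2
  have hw1 : ∀ i, C.bil (w i) 1 = 0 := by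
    intro i
    have h0 := hu 0
    have h1 := hu 1
    have h2 := hu 2
    simp only [w, CompositionAlgebra.bil, polar_add_left, polar_smul_left] at *
    rw [h0, h1, h2]
    simp
  have hww : ∀ i j, C.bil (w i) (w j) = 2 * (G * diagonal ![b * c, a * c, a * b] * Gᵀ) i j := by
    intro i j
    have h01 := huu 0 1 (by simp)
    have h02 := huu 0 2 (by simp)
    have h12 := huu 1 2 (by simp)
    have h10 := huu 1 0 (by simp)
    have h20 := huu 2 0 (by simp)
    have h21 := huu 2 1 (by simp)
    have n0 := hN 0
    have n1 := hN 1
    have n2 := hN 2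
    simp only [w, CompositionAlgebra.bil, polar_add_left, polar_smul_left, polar_add_right,
      polar_smul_right, polar_self] at *
    rw [h01, h02, h12, h10, h20, h21, n0, n1, n2, mul_apply, Fin.sum_univ_three]
    simp [mul_diagonal]
    ring
  rw [← h] at hww
  have hwN : ∀ i, C.norm (w i) = ![b' * c', a' * c', a' * b'] i := by
    intro i
    have := hww i i
    rw [CompositionAlgebra.bil, polar_self, nsmul_eq_mul, Nat.cast_ofNat, diagonal_apply_eq] at this
    exact mul_left_cancel₀ h2 this
  exact CompositionAlgebra.iso_alg4 h2 _ _ (CompositionAlgebra.finrank_le_four hr) (hw1 0) (hw1 1)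
    (by rw [hww]; simp) (hwN 0) (hwN 1)

theorem isoClass_eq_iff {C D : SmallCompositionAlgebra k} :
    isoClass C = isoClass D ↔ C.1.Iso D.1 := Quotient.eq

/-- The parameters of the normal forms. -/
inductive NormalForm (k : Type u) [Field k] : Type u
  | one : NormalForm k
  | two (a : k) (ha : a ≠ 0) : NormalForm k
  | four (a b c : k) (ha : a ≠ 0) (hb : b ≠ 0) (hc : c ≠ 0) : NormalForm k

/-! ### Comparison of orbits and algebras through their normal forms -/

namespace NormalForm

/-- The vector attached to a normal form. -/
def rep : NormalForm k → Wedge3 k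
  | one => rep1 k
  | two a _ => rep2 a
  | four a b c _ _ _ => rep4 a b c

/-- The composition algebra attached to a normal form. -/
def alg (h2 : (2 : k) ≠ 0) : NormalForm k → SmallCompositionAlgebra k
  | one => ⟨alg1 h2, rank_alg1_le h2⟩
  | two _ ha => ⟨alg2 h2 ha, rank_alg2_le h2 ha⟩
  | four _ _ _ ha hb hc =>
    ⟨alg4 h2 (mul_ne_zero hb hc) (mul_ne_zero ha hc), rank_alg4_le h2 _ _⟩

/-- The nonzero part of the covariant of a normal form. -/
def diag : NormalForm k → Fin 3 → k
  | one => ![0, 0, 0]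
  | two a _ => ![a, 0, 0]
  | four a b c _ _ _ => ![b * c, a * c, a * b]

theorem rep_mem (t : NormalForm k) : t.rep ∈ nonzeroNullCone k := by
  cases t with
  | one => exact rep1_mem
  | two a ha => exact rep2_mem a
  | four a b c ha hb hc => exact rep4_mem ha b c

theorem covariant_rep (t : NormalForm k) :
    covariant t.rep = fromBlocks ((-4 : k) • diagonal t.diag) 0 0 0 := by
  cases t with
  | one =>
    rw [rep, covariant_rep1, diag, ← diagonal_smul]
    congr 2
    funext i; fin_cases i <;> simp
  | two a ha =>
    rw [rep, covariant_rep2, diag, ← diagonal_smul]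
    congr 2
    funext i; fin_cases i <;> simp
  | four a b c ha hb hc =>
    rw [rep, covariant_rep4, diag, ← diagonal_smul]
    congr 2
    funext i; fin_cases i <;> simp

theorem exists_congruence (h2 : (2 : k) ≠ 0) {s t : NormalForm k} (h : t.rep ∈ spOrbit s.rep) :
    ∃ G : Matrix (Fin 3) (Fin 3) k, diagonal t.diag = G * diagonal s.diag * Gᵀ := by
  have h4 : (-4 : k) ≠ 0 := by
    rw [show (-4 : k) = -(2 * 2) by norm_num]; exact neg_ne_zero.mpr (mul_ne_zero h2 h2)
  obtain ⟨G, hG⟩ := congruent_of_mem_orbit s.covariant_rep t.covariant_rep h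
  refine ⟨G, smul_right_injective _ h4 ?_⟩
  simpa only [Matrix.mul_smul, Matrix.smul_mul] using hG

theorem det_diag_four {a b c : k} (ha : a ≠ 0) (hb : b ≠ 0) (hc : c ≠ 0) :
    (diagonal (four a b c ha hb hc).diag).det ≠ 0 := by
  simp [diag, Fin.prod_univ_three, ha, hb, hc]

theorem diag_two_ne_zero {a : k} (ha : a ≠ 0) : diagonal (two a ha).diag ≠ 0 := by
  intro h
  have := congrFun (congrFun h 0) 0
  simp [diag, ha] at this

theorem diag_one : diagonal (one : NormalForm k).diag = 0 := by
  ext i j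
  fin_cases i <;> fin_cases j <;> simp [diag]

theorem det_diag_two {a : k} (ha : a ≠ 0) : (diagonal (two a ha).diag).det = 0 := by
  simp [diag, Fin.prod_univ_three]

/-- Congruences in both directions exclude different types: the covariant vanishes for type one, is
nonzero but singular for type two, and is nonsingular on the block for type four. -/
theorem iso_of_mem_orbit (h2 : (2 : k) ≠ 0) {s t : NormalForm k} (h : t.rep ∈ spOrbit s.rep) :
    (s.alg h2).1.Iso (t.alg h2).1 := by
  obtain ⟨G, hG⟩ := exists_congruence h2 h
  obtain ⟨H, hH⟩ := exists_congruence h2 (spOrbit_symm h)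
  have hdet : ∀ {D E G : Matrix (Fin 3) (Fin 3) k}, D.det = 0 → E = G * D * Gᵀ → E.det = 0 := by
    rintro D E G hD rfl
    rw [det_mul, det_mul, hD, mul_zero, zero_mul]
  cases s with
  | one =>
    cases t with
    | one => exact ⟨LinearEquiv.refl k _, fun _ _ => rfl⟩
    | two a ha =>
      rw [diag_one, Matrix.mul_zero, Matrix.zero_mul] at hG
      exact absurd hG (diag_two_ne_zero ha)
    | four a b c ha hb hc =>
      rw [diag_one, Matrix.mul_zero, Matrix.zero_mul] at hG
      exact absurd (by rw [hG]; simp) (det_diag_four ha hb hc)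
  | two a ha =>
    cases t with
    | one =>
      rw [diag_one, Matrix.mul_zero, Matrix.zero_mul] at hH
      exact absurd hH (diag_two_ne_zero ha)
    | two b hb =>
      refine alg2_iso_of_eq h2 ha hb (s := G 0 0) ?_
      have h0 := congrFun (congrFun hG 0) 0
      rw [mul_apply, Fin.sum_univ_three] at h0
      simp [diag, mul_diagonal] at h0
      rw [h0]; ring
    | four a' b c ha' hb hc => exact absurd (hdet (det_diag_two ha) hG) (det_diag_four ha' hb hc)
  | four a b c ha hb hc =>
    cases t with
    | one =>
      rw [diag_one, Matrix.mul_zero, Matrix.zero_mul] at hH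
      exact absurd (by rw [hH]; simp) (det_diag_four ha hb hc)
    | two a' ha' => exact absurd (hdet (det_diag_two ha') hH) (det_diag_four ha hb hc)
    | four a' b' c' ha' hb' hc' => exact alg4_iso_of_congruent h2 ha hb hc ha' hb' hc' hG

theorem finrank_alg (h2 : (2 : k) ≠ 0) (t : NormalForm k) :
    Module.finrank k (t.alg h2).1.carrier =
      match t with
      | one => 1
      | two _ _ => 2
      | four _ _ _ _ _ _ => 4 := by
  cases t with
  | one => exact CompositionAlgebra.finrank_alg1 h2
  | two a ha => exact CompositionAlgebra.finrank_alg2 h2 ha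
  | four a b c ha hb hc => exact CompositionAlgebra.finrank_alg4 h2 (mul_ne_zero hb hc) (mul_ne_zero ha hc)

theorem mem_orbit_of_iso (h2 : (2 : k) ≠ 0) {s t : NormalForm k}
    (h : (s.alg h2).1.Iso (t.alg h2).1) : t.rep ∈ spOrbit s.rep := by
  have hd := CompositionAlgebra.finrank_eq_of_iso h
  rw [finrank_alg, finrank_alg] at hd
  cases s with
  | one =>
    cases t with
    | one => exact mem_spOrbit_self _
    | two a ha => simp at hd
    | four a b c ha hb hc => simp at hd
  | two a ha =>
    cases t with
    | one => simp at hd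
    | two b hb =>
      obtain ⟨s, hs⟩ := eq_of_alg2_iso h2 ha hb h
      exact rep2_mem_of_eq hb hs
    | four a b c ha hb hc => simp at hd
  | four a b c ha hb hc =>
    cases t with
    | one => simp at hd
    | two a ha => simp at hd
    | four a' b' c' ha' hb' hc' =>
      obtain ⟨G, hG⟩ := congruent_of_alg4_iso h2 ha hb hc ha' hb' hc' h
      exact rep4_mem_of_congruent ha hb hc ha' hb' hc' hG

theorem exists_rep_mem (h2 : (2 : k) ≠ 0) {x : Wedge3 k} (hx : x ∈ nonzeroNullCone k) :
    ∃ t : NormalForm k, t.rep ∈ spOrbit x := by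
  rcases exists_rep_mem_spOrbit h2 hx with h | ⟨a, ha, h⟩ | ⟨a, b, c, ha, hb, hc, h⟩
  · exact ⟨one, h⟩
  · exact ⟨two a ha, h⟩
  · exact ⟨four a b c ha hb hc, h⟩

theorem exists_alg_iso (h2 : (2 : k) ≠ 0) (C : SmallCompositionAlgebra k) :
    ∃ t : NormalForm k, C.1.Iso (t.alg h2).1 := by
  rcases CompositionAlgebra.iso_standard h2 C.2 with h | ⟨a, ha, h⟩ | ⟨a, b, ha, hb, h⟩
  · exact ⟨one, h⟩
  · exact ⟨two a ha, h⟩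
  -- The algebra of `four a' b' c'` has parameters `b'c'` and `a'c'`, so `(b, a, 1)` yields `(a,
  -- b)`.
  · refine ⟨four b a 1 hb ha one_ne_zero, ?_⟩
    simpa only [alg, mul_one] using h

/-- The orbit of a normal form. -/
def orbit (t : NormalForm k) : nullOrbits k := ⟨spGLOrbit t.rep, t.rep, t.rep_mem, rfl⟩

theorem mem_orbit_iff (h2 : (2 : k) ≠ 0) (t : NormalForm k) (O : nullOrbits k) :
    t.rep ∈ O.1 ↔ O = t.orbit := by
  obtain ⟨O, x, hx, rfl⟩ := O
  rw [Subtype.ext_iff]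
  change t.rep ∈ spGLOrbit x ↔ spGLOrbit x = spGLOrbit t.rep
  rw [spGLOrbit_eq h2 hx, spGLOrbit_eq h2 t.rep_mem, spOrbit_eq_iff]

theorem orbit_eq_iff (h2 : (2 : k) ≠ 0) (s t : NormalForm k) :
    s.orbit = t.orbit ↔ isoClass (s.alg h2) = isoClass (t.alg h2) := by
  rw [← mem_orbit_iff h2]
  change t.rep ∈ spGLOrbit s.rep ↔ _
  rw [spGLOrbit_eq h2 s.rep_mem, isoClass_eq_iff]
  exact ⟨iso_of_mem_orbit h2, mem_orbit_of_iso h2⟩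

theorem orbit_surjective (h2 : (2 : k) ≠ 0) : Function.Surjective (orbit (k := k)) := by
  rintro ⟨O, x, hx, rfl⟩
  obtain ⟨t, ht⟩ := exists_rep_mem h2 hx
  refine ⟨t, ((mem_orbit_iff h2 t _).mp ?_).symm⟩
  change t.rep ∈ spGLOrbit x
  rwa [spGLOrbit_eq h2 hx]

theorem isoClass_alg_surjective (h2 : (2 : k) ≠ 0) :
    Function.Surjective fun t : NormalForm k => isoClass (t.alg h2) := by
  intro c
  obtain ⟨C, rfl⟩ := Quotient.exists_rep c
  obtain ⟨t, ht⟩ := exists_alg_iso h2 C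
  exact ⟨t, Quotient.sound ht.symm⟩

end NormalForm

/-- Two surjections from one set with the same fibres have canonically identified targets. -/
theorem exists_equiv_of_surjective {α β γ : Type*} {f : α → β} {g : α → γ}
    (hf : Function.Surjective f) (hg : Function.Surjective g)
    (h : ∀ a b, f a = f b ↔ g a = g b) : ∃ Φ : β ≃ γ, ∀ a, Φ (f a) = g a := by
  have key : ∀ a, g (Function.surjInv hf (f a)) = g a := fun a =>
    (h _ _).mp (Function.surjInv_eq hf (f a))
  refine ⟨Equiv.ofBijective (fun b => g (Function.surjInv hf b)) ⟨fun b c hbc => ?_, fun c => ?_⟩,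
    key⟩
  · rw [← Function.surjInv_eq hf b, ← Function.surjInv_eq hf c]
    exact (h _ _).mpr hbc
  · obtain ⟨a, rfl⟩ := hg c
    exact ⟨f a, key a⟩

end SixSymplectic

end

theorem theorem5p1 (k : Type*) [Field k] (h2 : (2 : k) ≠ 0) :
    -- the scaling action does not change the orbits
    (∀ x ∈ SixSymplectic.nonzeroNullCone k,
      SixSymplectic.spGLOrbit x = SixSymplectic.spOrbit x) ∧
    -- every nonzero orbit in the null cone contains one of the normal forms, all of which lie
    -- in the nonzero null cone
    (∀ O ∈ SixSymplectic.nullOrbits k,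
      SixSymplectic.rep1 k ∈ O ∨
      (∃ a : k, a ≠ 0 ∧ SixSymplectic.rep2 a ∈ O) ∨
      (∃ a b c : k, a ≠ 0 ∧ b ≠ 0 ∧ c ≠ 0 ∧ SixSymplectic.rep4 a b c ∈ O)) ∧
    SixSymplectic.rep1 k ∈ SixSymplectic.nonzeroNullCone k ∧
    (∀ a : k, a ≠ 0 → SixSymplectic.rep2 a ∈ SixSymplectic.nonzeroNullCone k) ∧
    (∀ a b c : k, a ≠ 0 → b ≠ 0 → c ≠ 0 →
      SixSymplectic.rep4 a b c ∈ SixSymplectic.nonzeroNullCone k) ∧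
    -- the composition algebras of dimension at most four have dimension one, two or four
    (∀ C : SixSymplectic.SmallCompositionAlgebra k,
      Module.finrank k C.1.carrier = 1 ∨ Module.finrank k C.1.carrier = 2 ∨
        Module.finrank k C.1.carrier = 4) ∧
    -- the bijection, with the norm of the algebra attached to each normal form
    ∃ Φ : SixSymplectic.nullOrbits k ≃ SixSymplectic.SmallClasses k,
      ∀ (O : SixSymplectic.nullOrbits k) (C : SixSymplectic.SmallCompositionAlgebra k),
        Φ O = SixSymplectic.isoClass C →
        (SixSymplectic.rep1 k ∈ O.1 ↔ SixSymplectic.HasNorm C ![(1 : k)]) ∧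
        (∀ a : k, a ≠ 0 →
          (SixSymplectic.rep2 a ∈ O.1 ↔ SixSymplectic.HasNorm C ![1, -a])) ∧
        (∀ a b c : k, a ≠ 0 → b ≠ 0 → c ≠ 0 →
          (SixSymplectic.rep4 a b c ∈ O.1 ↔
            SixSymplectic.HasNorm C ![1, b * c, a * c, a * b])) := by
  open SixSymplectic in
  refine ⟨fun x hx => spGLOrbit_eq h2 hx, ?_, rep1_mem, fun a _ => rep2_mem a,
    fun a b c ha _ _ => rep4_mem ha b c, fun C => ?_, ?_⟩
  · rintro O ⟨x, hx, rfl⟩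
    rw [spGLOrbit_eq h2 hx]
    exact exists_rep_mem_spOrbit h2 hx
  · obtain ⟨t, ht⟩ := NormalForm.exists_alg_iso h2 C
    rw [CompositionAlgebra.finrank_eq_of_iso ht, NormalForm.finrank_alg]
    cases t <;> simp
  · obtain ⟨Φ, hΦ⟩ := exists_equiv_of_surjective (NormalForm.orbit_surjective h2)
      (NormalForm.isoClass_alg_surjective h2) (NormalForm.orbit_eq_iff h2)
    refine ⟨Φ, fun O C hOC => ?_⟩
    -- An orbit contains the vector of `t` exactly when it is the orbit of `t`, so injectivity of
    -- `Φ` turns membership into isomorphism with the algebra of `t`.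
    have key : ∀ t : NormalForm k, t.rep ∈ O.1 ↔ C.1.Iso (t.alg h2).1 := by
      intro t
      rw [NormalForm.mem_orbit_iff h2, ← Φ.injective.eq_iff, hΦ, hOC, isoClass_eq_iff]
    refine ⟨?_, fun a ha => ?_, fun a b c ha hb hc => ?_⟩
    · exact (key .one).trans (CompositionAlgebra.equivalent_alg1_iff h2 C.2).symm
    · exact (key (.two a ha)).trans (CompositionAlgebra.equivalent_alg2_iff h2 C.2 ha).symm
    · exact (key (.four a b c ha hb hc)).trans
        (CompositionAlgebra.equivalent_alg4_iff h2 C.2 ha hb hc).symm
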